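/- Let $N\ge 0$ and let $\mathfrak{S}_N^C$ be the Weyl group of type $C_N$, realised as the group of signed permutations of $\{1,\dots,N\}$ (bijections $\pi$ of $\{\pm1,\dots,\pm N\}$ with $\pi(-x)=-\pi(x)$), with generators $s_i$ ($1\le i\le N-1$) exchanging $i$ and $i+1$ (hence $-i$ and $-(i+1)$), and $s_N$ exchanging $N$ and $-N$. For $\pi\in\mathfrak{S}_N^C$ let $\mathrm{inv}_1(\pi)$ be the number of letters $s_1,\dots,s_{N-1}$, and $\mathrm{inv}_2(\pi)$ the number of letters $s_N$, in a reduced word for $\pi$. Let $\mathfrak{S}_N^C(\underline{1}2,\underline{12})$ be the set of $\pi\in\mathfrak{S}_N^C$ for which there are no $1\le i<j\le N$ with $\pi(i)<0$, $|\pi(i)|<|\pi(j)|$ and either $\pi(j)>0$ (pattern $\underline{1}2$) or $\pi(j)<0$ (pattern $\underline{12}$). Let $\mu$ be a lattice path of $N$ steps $U=(1,1)$ and $D=(1,-1)$ starting at the origin, and let $i_1<i_2<\dots<i_r$ be the positions of its $D$'s, counted from the right. Put $$\omega(\mu)=\omega_{i_1}\omega_{i_2}\cdots\omega_{i_r},\qquad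 \omega_i=s_{N-i+1}s_{N-i+2}\cdots s_N .$$ The shifted shape of $\mu$ is the set of boxes with corners $(x\pm1,y)$, $(x,y\pm1)$, where $x,y$ are integers with $x+y$ odd and $1\le x\le N$, that lie weakly below the path $\lambda_0=U^N$ from the origin (that is, $y+1\le x$) and whose lowest corner $(x,y-1)$ lies on or above $\mu$. The boxes with $x=N$ are called anchor boxes. For a step $U$ of $\lambda_0$ let $\mathrm{ht}(U)$ be one plus the number of boxes of the shifted shape in the $(1,-1)$-direction from $U$ (an anchor box included). Let $\mathrm{UP}_\ast(\mu)$, respectively $\mathrm{UP}_\circ(\mu)$, be the set of steps $U$ of $\lambda_0$ for which there is an anchor box, respectively no anchor box, of the shifted shape in the $(1,-1)$-direction from $U$. Write $[n]=\sum_{i=0}^{n-1}q^i$, and $[n]_t=[n-1]+q^{n-2}t$ for $n\ge2$ (if $U\in\mathrm{UP}_\ast(\mu)$, then $\mathrm{ht}(U)\ge2$). Then, with $\pi_0=\omega(\mu)$, $$\sum_{\substack{\pi\le\pi_0\\ \pi\in\mathfrak{S}_N^C(\underline{1}2,\underline{12})}} q^{\mathrm{inv}_1(\pi)}t^{\mathrm{inv}_2(\pi)}=\prod_{U\in\mathrm{UP}_\circ(\mu)}[\mathrm{ht}(U)]\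 \prod_{U\in\mathrm{UP}_\ast(\mu)}[\mathrm{ht}(U)]_t ,$$ where $\le$ is the Bruhat order on $\mathfrak{S}_N^C$, as an identity for all elements $q,t$ of any commutative ring (equivalently, as an identity of polynomials in $q$ and $t$). -/

import Mathlib

namespace TypeC

/-- The Weyl group of type `C_N` as the group of signed permutations of `1, …, N`: bijections
`π` of `ℤ` with `π (-x) = -π x` that fix every `x` with `|x| > N`.  The one-line notation of `π`
is `π 1, π 2, …, π N`. -/
def signedPerm (N : ℕ) : Subgroup (Equiv.Perm ℤ) where
  carrier := {π | (∀ x, π (-x) = -π x) ∧ ∀ x, (N : ℤ) < |x| → π x = x}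
  one_mem' := ⟨fun _ => rfl, fun _ _ => rfl⟩
  mul_mem' := by
    rintro a b ⟨ha, ha'⟩ ⟨hb, hb'⟩
    refine ⟨fun x => ?_, fun x hx => ?_⟩
    · simp [Equiv.Perm.mul_apply, ha, hb]
    · rw [Equiv.Perm.mul_apply, hb' x hx, ha' x hx]
  inv_mem' := by
    rintro a ⟨ha, ha'⟩
    refine ⟨fun x => ?_, fun x hx => ?_⟩
    · rw [Equiv.Perm.inv_eq_iff_eq, ha]
      simp
    · rw [Equiv.Perm.inv_eq_iff_eq, ha' x hx]

/-- A signed permutation is determined by its action on the finite set `[-N, N]`. -/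
instance signedPerm_finite (N : ℕ) : Finite (signedPerm N) := by
  have key : ∀ (π : signedPerm N) (x : ℤ), x ∈ Set.Icc (-(N : ℤ)) N →
      (π : Equiv.Perm ℤ) x ∈ Set.Icc (-(N : ℤ)) N := by
    intro π x hx
    by_contra h
    have h1 : (N : ℤ) < |(π : Equiv.Perm ℤ) x| := by
      rw [Set.mem_Icc, ← abs_le] at h
      exact not_le.mp h
    have h2 := (π : Equiv.Perm ℤ).injective (π.2.2 _ h1)
    rw [h2] at h
    exact h hx
  refine Finite.of_injective (β := Set.Icc (-(N : ℤ)) N → Set.Icc (-(N : ℤ)) N)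
    (fun π x => ⟨(π : Equiv.Perm ℤ) x, key π x x.2⟩) ?_
  intro a b hab
  apply Subtype.ext
  ext x
  by_cases hx : x ∈ Set.Icc (-(N : ℤ)) N
  · have := congrFun hab ⟨x, hx⟩
    simpa using this
  · have h1 : (N : ℤ) < |x| := by
      rw [Set.mem_Icc, ← abs_le] at hx
      exact not_le.mp hx
    rw [a.2.2 x h1, b.2.2 x h1]

noncomputable instance signedPerm_fintype (N : ℕ) : Fintype (signedPerm N) :=
  Fintype.ofFinite _

/-- The elementary transpositions.  The index `i : Fin N` is zero-based, so that `simple i` is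
`s_{i+1}`: it exchanges `i + 1` and `i + 2` (and `-(i + 1)` and `-(i + 2)`) if `i + 1 < N`, and for
`i + 1 = N` it is `s_N`, which exchanges `N` and `-N`. -/
def simple {N : ℕ} (i : Fin N) : signedPerm N :=
  ⟨if (i : ℕ) + 1 < N then
      Equiv.swap ((i : ℤ) + 1) ((i : ℤ) + 2) * Equiv.swap (-((i : ℤ) + 1)) (-((i : ℤ) + 2))
    else Equiv.swap (N : ℤ) (-(N : ℤ)), by
    have hi := i.2
    split_ifs with h
    · refine ⟨fun x => ?_, fun x hx => ?_⟩
      · simp only [Equiv.Perm.mul_apply, Equiv.swap_apply_def]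
        split_ifs <;> omega
      · rw [lt_abs] at hx
        simp only [Equiv.Perm.mul_apply, Equiv.swap_apply_def]
        split_ifs <;> omega
    · refine ⟨fun x => ?_, fun x hx => ?_⟩
      · simp only [Equiv.swap_apply_def]
        split_ifs <;> omega
      · rw [lt_abs] at hx
        simp only [Equiv.swap_apply_def]
        split_ifs <;> omega⟩

/-- The element of the Weyl group represented by a word in the elementary transpositions. -/
def wordProd {N : ℕ} (w : List (Fin N)) : signedPerm N := (w.map simple).prod

/-- The length of `π`: the least number of letters of a word representing `π`. -/
noncomputable def length {N : ℕ} (π : signedPerm N) : ℕ :=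
  sInf {n | ∃ w : List (Fin N), w.length = n ∧ wordProd w = π}

/-- `w` is a reduced word for `π`. -/
def IsReducedWord {N : ℕ} (π : signedPerm N) (w : List (Fin N)) : Prop :=
  wordProd w = π ∧ w.length = length π

theorem simple_apply_of_lt {N : ℕ} (i : Fin N) (h : (i : ℕ) + 1 < N) (x : ℤ) :
    (simple i : Equiv.Perm ℤ) x =
      if x = i + 1 then (i : ℤ) + 2 else if x = i + 2 then (i : ℤ) + 1
      else if x = -(i + 1) then -((i : ℤ) + 2) else if x = -(i + 2) then -((i : ℤ) + 1)
      else x := by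
  simp only [simple, if_pos h, Equiv.Perm.mul_apply, Equiv.swap_apply_def]
  split_ifs <;> omega

theorem simple_apply_of_not_lt {N : ℕ} (i : Fin N) (h : ¬ (i : ℕ) + 1 < N) (x : ℤ) :
    (simple i : Equiv.Perm ℤ) x = if x = N then -(N : ℤ) else if x = -N then (N : ℤ) else x := by
  simp only [simple, if_neg h, Equiv.swap_apply_def]

theorem wordProd_cons_apply {N : ℕ} (i : Fin N) (w : List (Fin N)) (x : ℤ) :
    (wordProd (i :: w) : Equiv.Perm ℤ) x =
      (simple i : Equiv.Perm ℤ) ((wordProd w : Equiv.Perm ℤ) x) := by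
  simp [wordProd, Equiv.Perm.mul_apply]

theorem exists_word_apply_pos {N k m : ℕ} (hk : 1 ≤ k) (hkm : k ≤ m) (hm : m ≤ N) :
    ∃ w : List (Fin N), (wordProd w : Equiv.Perm ℤ) k = m ∧
      ∀ x : ℤ, |x| < k → (wordProd w : Equiv.Perm ℤ) x = x := by
  induction m, hkm using Nat.le_induction with
  | base => exact ⟨[], by simp [wordProd], fun x _ => by simp [wordProd]⟩
  | succ m hkm ih =>
    obtain ⟨w, h1, h2⟩ := ih (by omega)
    refine ⟨⟨m - 1, by omega⟩ :: w, ?_, fun x hx => ?_⟩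
    · rw [wordProd_cons_apply, h1, simple_apply_of_lt _ (by simp only; omega)]
      simp only
      split_ifs <;> omega
    · rw [wordProd_cons_apply, h2 x hx, simple_apply_of_lt _ (by simp only; omega)]
      rw [abs_lt] at hx
      simp only
      split_ifs <;> omega

theorem exists_word_apply_neg {N k : ℕ} (hk : 1 ≤ k) (hkN : k ≤ N) (d : ℕ) (hd : k + d ≤ N) :
    ∃ w : List (Fin N), (wordProd w : Equiv.Perm ℤ) k = -((N : ℤ) - d) ∧
      ∀ x : ℤ, |x| < k → (wordProd w : Equiv.Perm ℤ) x = x := by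
  induction d with
  | zero =>
    obtain ⟨w, h1, h2⟩ := exists_word_apply_pos hk hkN le_rfl
    refine ⟨⟨N - 1, by omega⟩ :: w, ?_, fun x hx => ?_⟩
    · rw [wordProd_cons_apply, h1, simple_apply_of_not_lt _ (by simp only; omega)]
      simp
    · rw [wordProd_cons_apply, h2 x hx, simple_apply_of_not_lt _ (by simp only; omega)]
      rw [abs_lt] at hx
      split_ifs <;> omega
  | succ d ih =>
    obtain ⟨w, h1, h2⟩ := ih (by omega)
    refine ⟨⟨N - d - 2, by omega⟩ :: w, ?_, fun x hx => ?_⟩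
    · rw [wordProd_cons_apply, h1, simple_apply_of_lt _ (by simp only; omega)]
      simp only
      push_cast
      split_ifs <;> omega
    · rw [wordProd_cons_apply, h2 x hx, simple_apply_of_lt _ (by simp only; omega)]
      rw [abs_lt] at hx
      simp only
      split_ifs <;> omega

theorem wordProd_append {N : ℕ} (v w : List (Fin N)) :
    wordProd (v ++ w) = wordProd v * wordProd w := by
  simp [wordProd]

theorem wordProd_surjective_aux {N : ℕ} (d : ℕ) (π : signedPerm N)
    (h : ∀ x : ℤ, |x| + d < N + 1 → (π : Equiv.Perm ℤ) x = x) : ∃ w, wordProd w = π := by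
  induction d generalizing π with
  | zero =>
    refine ⟨[], ?_⟩
    apply Subtype.ext
    ext x
    by_cases hx : (N : ℤ) < |x|
    · rw [π.2.2 x hx]
      simp [wordProd]
    · rw [h x (by push_cast; omega)]
      simp [wordProd]
  | succ d ih =>
    by_cases hdN : d < N
    · obtain ⟨k, hk⟩ : ∃ k, k = N - d := ⟨_, rfl⟩
      have hfix : ∀ x : ℤ, |x| < k → (π : Equiv.Perm ℤ) x = x :=
        fun x hx => h x (by push_cast; omega)
      have hlow : (k : ℤ) ≤ |(π : Equiv.Perm ℤ) k| := by
        by_contra hc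
        have h1 := (π : Equiv.Perm ℤ).injective (hfix _ (not_le.mp hc))
        rw [h1] at hc
        exact hc (le_abs_self _)
      have hup : |(π : Equiv.Perm ℤ) k| ≤ N := by
        by_contra hc
        have h1 := (π : Equiv.Perm ℤ).injective (π.2.2 _ (not_le.mp hc))
        rw [h1] at hc
        rw [abs_of_nonneg (by positivity)] at hc
        omega
      obtain ⟨v, hv1, hv2⟩ : ∃ v : List (Fin N),
          (wordProd v : Equiv.Perm ℤ) k = (π : Equiv.Perm ℤ) k ∧
          ∀ x : ℤ, |x| < k → (wordProd v : Equiv.Perm ℤ) x = x := by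
        rcases le_total 0 ((π : Equiv.Perm ℤ) k) with h0 | h0
        · rw [abs_of_nonneg h0] at hlow hup
          obtain ⟨m, hm⟩ := Int.eq_ofNat_of_zero_le h0
          rw [hm] at hlow hup ⊢
          exact exists_word_apply_pos (by omega) (by omega) (by omega)
        · rw [abs_of_nonpos h0] at hlow hup
          obtain ⟨m, hm⟩ := Int.eq_ofNat_of_zero_le
            (show 0 ≤ (N : ℤ) + (π : Equiv.Perm ℤ) k by omega)
          have hm' : (π : Equiv.Perm ℤ) k = -((N : ℤ) - m) := by omega
          rw [hm']
          exact exists_word_apply_neg (by omega) (by omega) m (by omega)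
      obtain ⟨w, hw⟩ := ih ((wordProd v)⁻¹ * π) (by
        intro x hx
        simp only [Subgroup.coe_mul, Subgroup.coe_inv, Equiv.Perm.mul_apply]
        rw [Equiv.Perm.inv_eq_iff_eq]
        rcases lt_or_eq_of_le (show |x| ≤ (k : ℤ) by omega) with hlt | heq
        · rw [hfix x hlt, hv2 x hlt]
        · rcases (abs_eq (by positivity)).mp heq with rfl | rfl
          · exact hv1.symm
          · rw [π.2.1, (wordProd v).2.1, hv1])
      exact ⟨v ++ w, by rw [wordProd_append, hw]; group⟩
    · refine ih π fun x hx => ?_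
      have h0 : x = 0 := by
        have := abs_nonneg x
        exact abs_eq_zero.mp (by omega)
      have := π.2.1 0
      rw [h0]
      simp only [neg_zero] at this
      omega

/-- The elementary transpositions generate the group of signed permutations. -/
theorem wordProd_surjective {N : ℕ} (π : signedPerm N) : ∃ w, wordProd w = π := by
  refine wordProd_surjective_aux N π fun x hx => ?_
  have h0 : x = 0 := by
    have := abs_nonneg x
    exact abs_eq_zero.mp (by omega)
  have := π.2.1 0
  rw [h0]
  simp only [neg_zero] at this
  omega

theorem exists_isReducedWord {N : ℕ} (π : signedPerm N) : ∃ w, IsReducedWord π w := by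
  obtain ⟨w, h⟩ := wordProd_surjective π
  obtain ⟨v, hv, hv'⟩ := Nat.sInf_mem
    (s := {n | ∃ w : List (Fin N), w.length = n ∧ wordProd w = π}) ⟨_, w, rfl, h⟩
  exact ⟨v, hv', hv⟩

/-- A reduced word for `π`. -/
noncomputable def reducedWord {N : ℕ} (π : signedPerm N) : List (Fin N) :=
  (exists_isReducedWord π).choose

/-- The number of letters `s_1, …, s_{N-1}` in a reduced word for `π`. -/
noncomputable def inv₁ {N : ℕ} (π : signedPerm N) : ℕ :=
  (reducedWord π).countP (fun i => (i : ℕ) + 1 < N)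

/-- The number of letters `s_N` in a reduced word for `π`. -/
noncomputable def inv₂ {N : ℕ} (π : signedPerm N) : ℕ :=
  (reducedWord π).countP (fun i => (i : ℕ) + 1 = N)

/-- Reflections: the conjugates of the elementary transpositions. -/
def IsReflection {N : ℕ} (r : signedPerm N) : Prop :=
  ∃ (g : signedPerm N) (i : Fin N), r = g * simple i * g⁻¹

/-- The Bruhat order: `u ≤ v` if there is a chain from `u` to `v` in which every step is
multiplication by a reflection that increases the length. -/
def BruhatLE {N : ℕ} (u v : signedPerm N) : Prop :=
  Relation.ReflTransGen
    (fun a b : signedPerm N => ∃ r, IsReflection r ∧ b = a * r ∧ length a < length b) u v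

/-- The one-line notation of `π` contains the signed pattern `-1, 2`. -/
def ContainsBarOneTwo {N : ℕ} (π : signedPerm N) : Prop :=
  ∃ i j : ℤ, 1 ≤ i ∧ i < j ∧ j ≤ N ∧ (π : Equiv.Perm ℤ) i < 0 ∧ 0 < (π : Equiv.Perm ℤ) j ∧
    |(π : Equiv.Perm ℤ) i| < |(π : Equiv.Perm ℤ) j|

/-- The one-line notation of `π` contains the signed pattern `-1, -2`. -/
def ContainsBarOneBarTwo {N : ℕ} (π : signedPerm N) : Prop :=
  ∃ i j : ℤ, 1 ≤ i ∧ i < j ∧ j ≤ N ∧ (π : Equiv.Perm ℤ) i < 0 ∧ (π : Equiv.Perm ℤ) j < 0 ∧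
    |(π : Equiv.Perm ℤ) i| < |(π : Equiv.Perm ℤ) j|

/-- `π` avoids both signed patterns. -/
def IsAvoiding {N : ℕ} (π : signedPerm N) : Prop :=
  ¬ ContainsBarOneTwo π ∧ ¬ ContainsBarOneBarTwo π

/-- Up steps `(1, 1)` and down steps `(1, -1)`. -/
inductive Step : Type
  | U : Step
  | D : Step
  deriving DecidableEq

/-- The height of the path `μ`, which starts at the origin, above the abscissa `x`. -/
def height {N : ℕ} (μ : Fin N → Step) (x : ℤ) : ℤ :=
  ∑ k : Fin N, if (k : ℤ) < x then (if μ k = Step.U then 1 else -1) else 0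

/-- The word of `μ`: the `D`'s are read from right to left, and a `D` that is the `(k+1)`-st step
from the left, hence the `i`-th from the right with `i = N - k`, contributes
`s_{N-i+1} s_{N-i+2} ⋯ s_N = s_{k+1} s_{k+2} ⋯ s_N`. -/
def omegaWord {N : ℕ} (μ : Fin N → Step) : List (Fin N) :=
  (List.finRange N).reverse.flatMap fun k =>
    if μ k = Step.D then (List.finRange N).filter (fun j => k ≤ j) else []

/-- The signed permutation `ω(μ)`. -/
def omega {N : ℕ} (μ : Fin N → Step) : signedPerm N := wordProd (omegaWord μ)

/-- The shifted shape of `μ`, as the set of the centres `(x, y)` of its boxes.  The box with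
centre `(x, y)` has the corners `(x ± 1, y)` and `(x, y ± 1)`; it has to lie below the path
`U U ⋯ U` (that is, `y + 1 ≤ x`), weakly to the left of the line of the anchor boxes (`x ≤ N`), and
above the path `μ` (its lowest corner is on or above `μ`). -/
noncomputable def shape {N : ℕ} (μ : Fin N → Step) : Finset (ℤ × ℤ) :=
  (Finset.Icc 1 (N : ℤ) ×ˢ Finset.Icc (-(N : ℤ)) N).filter
    (fun b => Odd (b.1 + b.2) ∧ b.2 + 1 ≤ b.1 ∧ height μ b.1 ≤ b.2 - 1)

/-- The boxes of the shape in the direction `(1, -1)` from the `(i+1)`-st step of `U U ⋯ U`, the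
step from `(i, i)` to `(i + 1, i + 1)`: the first such box has centre `(i + 1, i)`. -/
noncomputable def boxes {N : ℕ} (μ : Fin N → Step) (i : Fin N) : Finset (ℤ × ℤ) :=
  (shape μ).filter (fun b => b.1 + b.2 = 2 * (i : ℤ) + 1)

/-- The height statistic of the `(i+1)`-st step of `U U ⋯ U`. -/
noncomputable def ht {N : ℕ} (μ : Fin N → Step) (i : Fin N) : ℕ := (boxes μ i).card + 1

/-- The steps of `U U ⋯ U` with an anchor box in direction `(1, -1)`. -/
noncomputable def upStar {N : ℕ} (μ : Fin N → Step) : Finset (Fin N) :=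
  Finset.univ.filter (fun i => ∃ b ∈ boxes μ i, b.1 = (N : ℤ))

/-- The steps of `U U ⋯ U` with no anchor box in direction `(1, -1)`. -/
noncomputable def upCirc {N : ℕ} (μ : Fin N → Step) : Finset (Fin N) :=
  Finset.univ.filter (fun i => ¬ ∃ b ∈ boxes μ i, b.1 = (N : ℤ))

/-- The `q`-integer `[n] = 1 + q + ⋯ + q^{n-1}`. -/
def qInt {R : Type*} [CommRing R] (q : R) (n : ℕ) : R := ∑ i ∈ Finset.range n, q ^ i

/-- The `q,t`-integer `[n]_t = [n-1] + q^{n-2} t`, used for `n ≥ 2` only. -/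
def qtInt {R : Type*} [CommRing R] (q t : R) (n : ℕ) : R := qInt q (n - 1) + q ^ (n - 2) * t

end TypeC

namespace TypeC

/-! ### Elementary facts on signed permutations. -/

variable {N : ℕ}

/-! Call `s_{i+c} ⋯ s_{i+2} s_{i+1}` a block. Avoidance means that every negative letter exceeds all
later letters in absolute value. If the first `k` positions are fixed, the letter at position `k +
1` is therefore either positive or `-N`. These are exactly the values that a block starting at `k`
can produce, and stripping that block leaves an avoiding signed permutation with one more fixed
position. Hence the avoiding elements are the products of blocks of lengths `a 0, …, a (N-1)` with
`i + a i ≤ N` (`exists_codePerm_eq`), and `code` recovers the lengths (`code_codePerm`).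

The resulting words are reduced. Inversions and negative letters bound from below the two kinds of
letters in any word, and for a code word these bounds already add up to its length
(`codeWord_counts`). So `inv₁` and `inv₂` can be read off the blocks, and the weight is a product
over `i` (`weight_codePerm`).

The element `ω(μ)` is itself such a product, its code being the numbers of boxes on the diagonals of
the shape (`omega_eq_codePerm`). An avoiding element lies below it exactly when its code is
componentwise at most this one (`bruhatLE_omega_and_isAvoiding_iff`). Deleting leading letters of
blocks gives one direction (`bruhatLE_codePerm`). The other compares ranks, which are monotone in
the Bruhat order by the exchange property (`BruhatLE.rank_le`, `code_le_boxCount`).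

The sum thus runs over a product of intervals and factors. The factor of a diagonal is a
`q`-integer; its last term acquires `t` exactly when the diagonal reaches an anchor box, since only
a block of full length `N - i` contains `s_N`. -/

theorem apply_neg (π : signedPerm N) (x : ℤ) : π.1 (-x) = -π.1 x := π.2.1 x

theorem mul_apply (π ρ : signedPerm N) (x : ℤ) : (π * ρ).1 x = π.1 (ρ.1 x) := rfl

theorem apply_inv_apply (π : signedPerm N) (x : ℤ) : π.1 ((π⁻¹).1 x) = x := by
  rw [← mul_apply, mul_inv_cancel]; rfl

theorem inv_apply_apply (π : signedPerm N) (x : ℤ) : (π⁻¹).1 (π.1 x) = x := by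
  rw [← mul_apply, inv_mul_cancel]; rfl

theorem signedPerm_ext {π ρ : signedPerm N} (h : ∀ x, π.1 x = ρ.1 x) : π = ρ :=
  Subtype.ext (Equiv.ext h)

theorem apply_zero (π : signedPerm N) : π.1 0 = 0 := by
  have := apply_neg π 0
  rw [neg_zero] at this
  omega

theorem apply_ne_zero (π : signedPerm N) {x : ℤ} (hx : x ≠ 0) : π.1 x ≠ 0 := fun h =>
  hx (π.1.injective (h.trans (apply_zero π).symm))

theorem abs_apply_le (π : signedPerm N) {x : ℤ} (hx : |x| ≤ N) : |π.1 x| ≤ N := by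
  by_contra hc
  have h1 := π.1.injective (π.2.2 _ (not_le.mp hc))
  rw [h1] at hc
  exact hc hx

theorem abs_apply_eq_iff (π : signedPerm N) {x y : ℤ} : |π.1 x| = |π.1 y| ↔ |x| = |y| := by
  rw [abs_eq_abs, abs_eq_abs, ← apply_neg, π.1.injective.eq_iff, π.1.injective.eq_iff]

theorem abs_le_of_apply_ne (π : signedPerm N) {x : ℤ} (hx : π.1 x ≠ x) : |x| ≤ N := by
  by_contra hc
  exact hx (π.2.2 _ (not_le.mp hc))

theorem ne_zero_of_apply_ne (π : signedPerm N) {x : ℤ} (hx : π.1 x ≠ x) : x ≠ 0 := by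
  rintro rfl
  exact hx (apply_zero π)

/-! ### The order on letters, and reflections. -/

/-- The position of a letter in the order `1, 2, …, N, -N, …, -2, -1`. -/
def key (N : ℕ) (x : ℤ) : ℤ := if 0 < x then x else 2 * N + 1 + x

theorem key_cases (N : ℕ) (x : ℤ) :
    (0 < x ∧ key N x = x) ∨ (x ≤ 0 ∧ key N x = 2 * N + 1 + x) := by
  unfold key
  split_ifs <;> omega

theorem key_ne_key {x y : ℤ} (hx : |x| ≤ N) (hy : |y| ≤ N) (h : x ≠ y) : key N x ≠ key N y := by
  rw [abs_le] at hx hy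
  unfold key
  split_ifs <;> omega

theorem simple_simple_apply (i : Fin N) (x : ℤ) : (simple i).1 ((simple i).1 x) = x := by
  by_cases h : (i : ℕ) + 1 < N
  · simp only [simple_apply_of_lt i h]
    split_ifs <;> omega
  · simp only [simple_apply_of_not_lt i h]
    split_ifs <;> omega

theorem simple_apply_of_ne (i : Fin N) {z x : ℤ} (hz : (simple i).1 z ≠ z) (h1 : x ≠ z)
    (h2 : x ≠ -z) (h3 : x ≠ (simple i).1 z) (h4 : x ≠ -(simple i).1 z) :
    (simple i).1 x = x := by
  by_cases h : (i : ℕ) + 1 < N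
  · simp only [simple_apply_of_lt i h] at *
    split_ifs at * <;> omega
  · simp only [simple_apply_of_not_lt i h] at *
    split_ifs at * <;> omega

theorem IsReflection.apply_apply {r : signedPerm N} (hr : IsReflection r) (x : ℤ) :
    r.1 (r.1 x) = x := by
  obtain ⟨g, i, rfl⟩ := hr
  simp only [mul_apply, inv_apply_apply, simple_simple_apply, apply_inv_apply]

theorem IsReflection.apply_of_ne {r : signedPerm N} (hr : IsReflection r) {z x : ℤ}
    (hz : r.1 z ≠ z) (h1 : x ≠ z) (h2 : x ≠ -z) (h3 : x ≠ r.1 z) (h4 : x ≠ -r.1 z) :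
    r.1 x = x := by
  obtain ⟨g, i, rfl⟩ := hr
  simp only [mul_apply] at *
  have key : ∀ y, x ≠ g.1 y → (g⁻¹).1 x ≠ y := by
    rintro y hy rfl
    exact hy (apply_inv_apply g x).symm
  rw [simple_apply_of_ne i (z := (g⁻¹).1 z), apply_inv_apply]
  · intro h
    rw [h, apply_inv_apply] at hz
    exact hz rfl
  · exact key _ (by rwa [apply_inv_apply])
  · exact key _ (by rwa [apply_neg, apply_inv_apply])
  · exact key _ h3
  · exact key _ (by rwa [apply_neg])

/-- A reflection moves only `±z` and `±r z` once it moves `z`, so one moved letter determines it. In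
the exchange property this identifies the letter to be deleted. -/
theorem IsReflection.eq_of_apply_eq {r r' : signedPerm N} (hr : IsReflection r)
    (hr' : IsReflection r') {z : ℤ} (hz : r.1 z ≠ z) (h : r.1 z = r'.1 z) : r = r' := by
  refine signedPerm_ext fun x => ?_
  by_cases h1 : x = z
  · rw [h1, h]
  by_cases h2 : x = -z
  · rw [h2, apply_neg, apply_neg, h]
  by_cases h3 : x = r.1 z
  · rw [h3, hr.apply_apply, h, hr'.apply_apply]
  by_cases h4 : x = -r.1 z
  · rw [h4, apply_neg, apply_neg, hr.apply_apply, h, hr'.apply_apply]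
  rw [hr.apply_of_ne hz h1 h2 h3 h4, hr'.apply_of_ne (h ▸ hz) h1 h2 (h ▸ h3) (h ▸ h4)]

theorem isReflection_simple (i : Fin N) : IsReflection (simple i) := ⟨1, i, by simp⟩

theorem IsReflection.conj {r : signedPerm N} (hr : IsReflection r) (g : signedPerm N) :
    IsReflection (g * r * g⁻¹) := by
  obtain ⟨h, i, rfl⟩ := hr
  exact ⟨g * h, i, by group⟩

theorem simple_mul_simple (i : Fin N) : simple i * simple i = 1 :=
  signedPerm_ext fun x => simple_simple_apply i x

/-- An elementary transposition reverses the order of two letters only by exchanging them. -/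
theorem simple_apply_eq_of_key_lt (i : Fin N) {u v : ℤ} (hu : |u| ≤ N) (hv : |v| ≤ N)
    (h1 : key N v < key N u)
    (h2 : key N ((simple i).1 u) < key N ((simple i).1 v)) : (simple i).1 u = v := by
  rw [abs_le] at hu hv
  have hi := i.2
  have hk (x : ℤ) := key_cases N x
  have k1 := hk u
  have k2 := hk v
  have k3 := hk ((simple i).1 u)
  have k4 := hk ((simple i).1 v)
  by_cases h : (i : ℕ) + 1 < N
  · have e1 := simple_apply_of_lt i h u
    have e2 := simple_apply_of_lt i h v
    generalize (simple i).1 u = u' at *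
    generalize (simple i).1 v = v' at *
    split_ifs at e1 <;> split_ifs at e2 <;> omega
  · have e1 := simple_apply_of_not_lt i h u
    have e2 := simple_apply_of_not_lt i h v
    generalize (simple i).1 u = u' at *
    generalize (simple i).1 v = v' at *
    split_ifs at e1 <;> split_ifs at e2 <;> omega

/-! ### The exchange property and the monotonicity of ranks. -/

theorem wordProd_cons (i : Fin N) (w : List (Fin N)) :
    wordProd (i :: w) = simple i * wordProd w := by
  simp [wordProd]

/-- The exchange property. -/
theorem exists_shorter_word (w : List (Fin N)) {r : signedPerm N} (hr : IsReflection r) {z : ℤ}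
    (h1 : key N (r.1 z) < key N z)
    (h2 : key N ((wordProd w).1 z) < key N ((wordProd w).1 (r.1 z))) :
    ∃ v : List (Fin N), v.length < w.length ∧ wordProd v = wordProd w * r := by
  have hz : r.1 z ≠ z := fun h => by rw [h] at h1; exact lt_irrefl _ h1
  have hzN := abs_le_of_apply_ne r hz
  induction w with
  | nil =>
    have : wordProd ([] : List (Fin N)) = 1 := by simp [wordProd]
    rw [this] at h2
    exact absurd h1 (not_lt.mpr h2.le)
  | cons s w ih =>
    have hne : (wordProd w).1 z ≠ (wordProd w).1 (r.1 z) := fun h =>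
      hz ((wordProd w).1.injective h).symm
    have b1 := abs_apply_le (wordProd w) hzN
    have b2 := abs_apply_le (wordProd w) (abs_apply_le r hzN)
    rcases lt_or_gt_of_ne (key_ne_key b1 b2 hne) with hlt | hgt
    · obtain ⟨v, hv, hv'⟩ := ih hlt
      exact ⟨s :: v, by simpa using hv, by rw [wordProd_cons, wordProd_cons, hv', mul_assoc]⟩
    -- The letter `s` itself creates the inversion, so it exchanges the two images. It is then the
    -- conjugate of `r` by `wordProd w`, and multiplying by `r` cancels it.
    · rw [wordProd_cons, mul_apply, mul_apply] at h2
      have hs := simple_apply_eq_of_key_lt s b1 b2 hgt h2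
      have heq : simple s = wordProd w * r * (wordProd w)⁻¹ := by
        refine (isReflection_simple s).eq_of_apply_eq (hr.conj _) (z := (wordProd w).1 z) ?_ ?_
        · rw [hs]; exact hne.symm
        · rw [hs, mul_apply, mul_apply, inv_apply_apply]
      refine ⟨w, by simp, ?_⟩
      have : wordProd w * r = simple s * wordProd w := by rw [heq]; group
      rw [wordProd_cons, mul_assoc, this, ← mul_assoc, simple_mul_simple, one_mul]

theorem length_le_of_wordProd_eq {π : signedPerm N} {w : List (Fin N)} (h : wordProd w = π) :
    length π ≤ w.length :=
  Nat.sInf_le ⟨w, rfl, h⟩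

/-- Otherwise the exchange property, applied to a reduced word for `a`, would make `a * r` shorter
than `a`. -/
theorem key_lt_of_length_lt {a r : signedPerm N} (hr : IsReflection r)
    (h : length a < length (a * r)) {z : ℤ} (h1 : key N (r.1 z) < key N z) :
    key N (a.1 (r.1 z)) < key N (a.1 z) := by
  have hz : r.1 z ≠ z := fun h => by rw [h] at h1; exact lt_irrefl _ h1
  have hzN := abs_le_of_apply_ne r hz
  by_contra hc
  obtain ⟨w, rfl, hw⟩ := exists_isReducedWord a
  have hne := key_ne_key (abs_apply_le (wordProd w) (abs_apply_le r hzN))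
    (abs_apply_le (wordProd w) hzN) (fun h => hz ((wordProd w).1.injective h))
  obtain ⟨v, hv, hv'⟩ := exists_shorter_word w hr h1 (by omega)
  have := length_le_of_wordProd_eq hv'
  omega

/-- The number of the first `n` letters of `π` whose place in the order
`1, 2, …, N, -N, …, -2, -1` is at most `V`. -/
noncomputable def rank (π : signedPerm N) (n : ℕ) (V : ℤ) : ℕ :=
  ((Finset.Icc 1 (n : ℤ)).filter fun a => key N (π.1 a) ≤ V).card

/-- A position counted for `a * r` is kept if it also counts for `a`, and is replaced by its image
under `r` otherwise. In the second case the image precedes it in the order of letters, hence is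
again a position from `1` to `n`. -/
theorem rank_le_of_length_lt {a r : signedPerm N} (hr : IsReflection r)
    (h : length a < length (a * r)) (n : ℕ) (V : ℤ) :
    rank (a * r) n V ≤ rank a n V := by
  unfold rank
  refine Finset.card_le_card_of_injOn (fun z => if key N (a.1 z) ≤ V then z else r.1 z) ?_ ?_
  · intro z hz
    simp only [Finset.mem_coe, Finset.mem_filter, Finset.mem_Icc] at hz ⊢
    rw [mul_apply] at hz
    split_ifs with h1
    · exact ⟨hz.1, h1⟩
    · have hzr : r.1 z ≠ z := fun h => by rw [h] at hz; exact h1 hz.2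
      have hzN := abs_le_of_apply_ne r hzr
      have hrN := abs_apply_le r hzN
      have hr0 := apply_ne_zero r (ne_zero_of_apply_ne r hzr)
      have hlt : key N (r.1 z) < key N z := by
        by_contra hc
        have hc' : key N (r.1 (r.1 z)) < key N (r.1 z) := by
          have := key_ne_key hrN hzN hzr
          rw [hr.apply_apply]
          omega
        have := key_lt_of_length_lt hr h hc'
        rw [hr.apply_apply] at this
        omega
      refine ⟨?_, hz.2⟩
      rw [abs_le] at hzN hrN
      unfold key at hlt
      split_ifs at hlt <;> omega
  · intro z hz y hy hzy
    simp only [Finset.mem_coe, Finset.mem_filter, Finset.mem_Icc] at hz hy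
    rw [mul_apply] at hz hy
    simp only at hzy
    split_ifs at hzy with h1 h2 h2
    · exact hzy
    · rw [hzy, hr.apply_apply] at hz
      exact absurd hz.2 h2
    · rw [← hzy, hr.apply_apply] at hy
      exact absurd hy.2 h1
    · exact r.1.injective hzy

theorem BruhatLE.rank_le {π ρ : signedPerm N} (h : BruhatLE π ρ) (n : ℕ) (V : ℤ) :
    rank ρ n V ≤ rank π n V := by
  induction h with
  | refl => exact le_rfl
  | tail _ hstep ih =>
    obtain ⟨r, hr, rfl, hlt⟩ := hstep
    exact (rank_le_of_length_lt hr hlt n V).trans ih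

/-! ### Blocks, code words and their action. -/

/-- The word `s_{i+c} ⋯ s_{i+2} s_{i+1}` with `c` letters. -/
def block (N i : ℕ) : ℕ → List (Fin N)
  | 0 => []
  | c + 1 => if h : i + c < N then ⟨i + c, h⟩ :: block N i c else block N i c

/-- The concatenation of the `d` words `block N i (a i)` with `k ≤ i < k + d`. -/
def codeWord (N : ℕ) (a : ℕ → ℕ) (k : ℕ) : ℕ → List (Fin N)
  | 0 => []
  | d + 1 => block N k (a k) ++ codeWord N a (k + 1) d

/-- The signed permutation represented by `codeWord`. -/
def codePerm (N : ℕ) (a : ℕ → ℕ) (k d : ℕ) : signedPerm N := wordProd (codeWord N a k d)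

theorem wordProd_nil : wordProd ([] : List (Fin N)) = 1 := by simp [wordProd]

theorem codePerm_zero (a : ℕ → ℕ) (k : ℕ) : codePerm N a k 0 = 1 := wordProd_nil

theorem codePerm_succ (a : ℕ → ℕ) (k d : ℕ) :
    codePerm N a k (d + 1) = wordProd (block N k (a k)) * codePerm N a (k + 1) d :=
  wordProd_append _ _

theorem codeWord_congr {a b : ℕ → ℕ} {k d : ℕ} (h : ∀ i, k ≤ i → i < k + d → a i = b i) :
    codeWord N a k d = codeWord N b k d := by
  induction d generalizing k with
  | zero => rfl
  | succ d ih =>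
    rw [codeWord, codeWord, h k le_rfl (by omega), ih fun i hi hi' => h i (by omega) (by omega)]

/-- Each new letter raises the image of `i + 1` by one, until `s_N` turns `N` into `-N`. The letters
passed on the way drop by one. Only `i + c = N` produces a sign. -/
theorem block_apply {i c : ℕ} (hi : i < N) (hc : i + c ≤ N) (x : ℤ) :
    (wordProd (block N i c)).1 x =
      if x = i + 1 then (if i + c < N then (i : ℤ) + c + 1 else -(N : ℤ))
      else if x = -(i + 1) then (if i + c < N then -((i : ℤ) + c + 1) else (N : ℤ))
      else if (i : ℤ) + 2 ≤ x ∧ x ≤ i + c + 1 ∧ x ≤ N then x - 1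
      else if x ≤ -((i : ℤ) + 2) ∧ -(i + c + 1 : ℤ) ≤ x ∧ -(N : ℤ) ≤ x then x + 1
      else x := by
  induction c with
  | zero =>
    simp only [block, wordProd_nil]
    change x = _
    push_cast
    split_ifs <;> omega
  | succ c ih =>
    have h : i + c < N := by omega
    rw [block, dif_pos h, wordProd_cons, mul_apply, ih (by omega)]
    generalize hy : (if x = (i : ℤ) + 1 then _ else _ : ℤ) = y
    rw [if_pos h, if_pos h] at hy
    by_cases h' : i + c + 1 < N
    · rw [simple_apply_of_lt _ h', if_pos (show i + (c + 1) < N by omega),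
        if_pos (show i + (c + 1) < N by omega)]
      simp only
      push_cast
      split_ifs at hy <;> split_ifs <;> omega
    · rw [simple_apply_of_not_lt _ h', if_neg (show ¬ i + (c + 1) < N by omega),
        if_neg (show ¬ i + (c + 1) < N by omega)]
      push_cast
      split_ifs at hy <;> split_ifs <;> omega

theorem block_apply_of_abs_le {i c : ℕ} (hi : i < N) (hc : i + c ≤ N) {x : ℤ} (hx : |x| ≤ i) :
    (wordProd (block N i c)).1 x = x := by
  rw [abs_le] at hx
  rw [block_apply hi hc]
  split_ifs <;> omega

/-- `block` preserves signs and the order of the absolute values beyond the letter `i + 1`. -/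
theorem block_apply_neg_iff {i c : ℕ} (hi : i < N) (hc : i + c ≤ N) {x : ℤ}
    (hx : (i : ℤ) + 1 < |x|) : (wordProd (block N i c)).1 x < 0 ↔ x < 0 := by
  rw [lt_abs] at hx
  rw [block_apply hi hc]
  split_ifs <;> omega

theorem abs_block_apply {i c : ℕ} (hi : i < N) (hc : i + c ≤ N) {x : ℤ}
    (hx : (i : ℤ) + 1 < |x|) (hx' : |x| ≤ N) :
    |(wordProd (block N i c)).1 x| = if |x| ≤ i + c + 1 then |x| - 1 else |x| := by
  rw [lt_abs] at hx
  rw [abs_le] at hx'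
  rw [block_apply hi hc]
  rcases hx with h | h
  · rw [abs_of_pos (a := x) (by omega)]
    split_ifs <;> first | omega | (rw [abs_of_pos] <;> omega)
  · rw [abs_of_neg (a := x) (by omega)]
    split_ifs <;> first | omega | (rw [abs_of_neg] <;> omega)

theorem abs_block_apply_lt_iff {i c : ℕ} (hi : i < N) (hc : i + c ≤ N) {x y : ℤ}
    (hx : (i : ℤ) + 1 < |x|) (hx' : |x| ≤ N) (hy : (i : ℤ) + 1 < |y|) (hy' : |y| ≤ N) :
    |(wordProd (block N i c)).1 x| < |(wordProd (block N i c)).1 y| ↔ |x| < |y| := by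
  rw [abs_block_apply hi hc hx hx', abs_block_apply hi hc hy hy']
  split_ifs <;> omega

theorem block_apply_self {i c : ℕ} (hi : i < N) (hc : i + c ≤ N) :
    (wordProd (block N i c)).1 ((i : ℤ) + 1) =
      if i + c < N then (i : ℤ) + c + 1 else -(N : ℤ) := by
  rw [block_apply hi hc, if_pos rfl]

theorem lt_abs_apply_of_fix {π : signedPerm N} {k : ℕ}
    (h : ∀ x : ℤ, |x| ≤ k → π.1 x = x) {x : ℤ} (hx : (k : ℤ) < |x|) : (k : ℤ) < |π.1 x| := by
  by_contra hc
  rw [π.1.injective (h _ (not_lt.mp hc))] at hc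
  exact hc hx

theorem codePerm_apply_of_abs_le {a : ℕ → ℕ} {k d : ℕ} (hk : k + d = N)
    (ha : ∀ i, k ≤ i → i < N → i + a i ≤ N) {x : ℤ} (hx : |x| ≤ k) :
    (codePerm N a k d).1 x = x := by
  induction d generalizing k with
  | zero => rw [codePerm_zero]; rfl
  | succ d ih =>
    rw [codePerm_succ, mul_apply,
      ih (by omega) (fun i hi => ha i (by omega)) (by push_cast; omega),
      block_apply_of_abs_le (by omega) (ha k le_rfl (by omega)) hx]

/-! ### Avoiding signed permutations are the products of blocks. -/

/-- Every negative letter exceeds all later letters in absolute value. -/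
def NegDominates (π : signedPerm N) : Prop :=
  ∀ i j : ℤ, 1 ≤ i → i < j → j ≤ N → π.1 i < 0 → |π.1 j| < |π.1 i|

theorem isAvoiding_iff_negDominates (π : signedPerm N) : IsAvoiding π ↔ NegDominates π := by
  constructor
  · rintro ⟨h1, h2⟩ i j hi hij hj hneg
    by_contra hc
    have hne : |π.1 i| ≠ |π.1 j| := fun h => by
      rw [abs_apply_eq_iff, abs_of_pos (by omega), abs_of_pos (by omega)] at h
      omega
    rcases lt_trichotomy (π.1 j) 0 with h | h | h
    · exact h2 ⟨i, j, hi, hij, hj, hneg, h, by omega⟩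
    · exact apply_ne_zero π (by omega) h
    · exact h1 ⟨i, j, hi, hij, hj, hneg, h, by omega⟩
  · intro h
    constructor
    · rintro ⟨i, j, hi, hij, hj, hneg, -, hlt⟩
      exact absurd (h i j hi hij hj hneg) hlt.not_gt
    · rintro ⟨i, j, hi, hij, hj, hneg, -, hlt⟩
      exact absurd (h i j hi hij hj hneg) hlt.not_gt

/-- Beyond the letter `k + 1` a block keeps signs and the order of absolute values. The letter it
puts at position `k + 1` is positive or `-N`, so it imposes no condition on the later ones. -/
theorem negDominates_block_mul {k c : ℕ} (hk : k < N) (hc : k + c ≤ N) {ρ : signedPerm N}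
    (hρ : ∀ x : ℤ, |x| ≤ (k + 1 : ℕ) → ρ.1 x = x) :
    NegDominates (wordProd (block N k c) * ρ) ↔ NegDominates ρ := by
  have hgt : ∀ x : ℤ, (k : ℤ) + 1 < x → (k : ℤ) + 1 < |ρ.1 x| := fun x hx => by
    have := lt_abs_apply_of_fix hρ (x := x) (by rw [abs_of_pos (by omega)]; push_cast; omega)
    push_cast at this
    exact this
  have hle : ∀ x : ℤ, 1 ≤ x → x ≤ N → |ρ.1 x| ≤ N := fun x hx hx' =>
    abs_apply_le ρ (by rwa [abs_of_pos (by omega)])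
  have hfix : ∀ x : ℤ, 1 ≤ x → x ≤ (k : ℤ) + 1 → ρ.1 x = x := fun x hx hx' =>
    hρ x (by rw [abs_of_pos (by omega)]; push_cast; omega)
  constructor
  · intro h i j hi hij hj hneg
    have hi' : (k : ℤ) + 1 < i := by
      by_contra hc'
      rw [hfix i hi (by omega)] at hneg
      omega
    have := h i j hi hij hj ((block_apply_neg_iff hk hc (hgt i hi')).mpr hneg)
    exact (abs_block_apply_lt_iff hk hc (hgt j (by omega)) (hle j (by omega) hj) (hgt i hi')
      (hle i hi (by omega))).mp this
  · intro h i j hi hij hj hneg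
    rw [mul_apply] at hneg
    rcases lt_trichotomy i ((k : ℤ) + 1) with hi' | hi' | hi'
    · rw [hfix i hi hi'.le, block_apply_of_abs_le hk hc (by rw [abs_of_pos] <;> omega)] at hneg
      omega
    · rw [mul_apply, mul_apply, hfix i hi hi'.le, hi']
      rw [hfix i hi hi'.le, hi', block_apply_self hk hc] at hneg
      rw [block_apply_self hk hc]
      have hkc : ¬ k + c < N := fun h => by rw [if_pos h] at hneg; omega
      rw [if_neg hkc] at hneg ⊢
      rw [abs_block_apply hk hc (hgt j (by omega)) (hle j (by omega) hj), abs_of_neg hneg]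
      have := hle j (by omega) hj
      split_ifs <;> omega
    · rw [block_apply_neg_iff hk hc (hgt i hi')] at hneg
      exact (abs_block_apply_lt_iff hk hc (hgt j (by omega)) (hle j (by omega) hj) (hgt i hi')
        (hle i hi (by omega))).mpr (h i j hi hij hj hneg)

theorem codePerm_negDominates {a : ℕ → ℕ} {k d : ℕ} (hk : k + d = N)
    (ha : ∀ i, k ≤ i → i < N → i + a i ≤ N) : NegDominates (codePerm N a k d) := by
  induction d generalizing k with
  | zero =>
    intro i j hi _ _ hneg
    rw [codePerm_zero] at hneg
    change i < 0 at hneg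
    omega
  | succ d ih =>
    have ha' : ∀ i, k + 1 ≤ i → i < N → i + a i ≤ N := fun i hi => ha i (by omega)
    rw [codePerm_succ, negDominates_block_mul (by omega) (ha k le_rfl (by omega))
      fun x hx => codePerm_apply_of_abs_le (by omega) ha' hx]
    exact ih (by omega) ha'

theorem exists_apply_eq_of_abs (π : signedPerm N) {v : ℤ} (hv : 0 < v) (hv' : v ≤ N) :
    ∃ x : ℤ, 1 ≤ x ∧ x ≤ N ∧ |π.1 x| = v := by
  have h0 := apply_ne_zero π⁻¹ hv.ne'
  have hN := abs_apply_le π⁻¹ (x := v) (by rwa [abs_of_pos hv])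
  have h1 := apply_inv_apply π v
  rcases lt_or_gt_of_ne h0 with h | h
  · rw [abs_of_neg h] at hN
    exact ⟨_, by omega, hN, by rw [apply_neg, h1, abs_neg, abs_of_pos hv]⟩
  · rw [abs_of_pos h] at hN
    exact ⟨_, h, hN, by rw [h1, abs_of_pos hv]⟩

theorem exists_codePerm_eq {k d : ℕ} (hk : k + d = N) {π : signedPerm N}
    (hfix : ∀ x : ℤ, |x| ≤ k → π.1 x = x) (hπ : NegDominates π) :
    ∃ a : ℕ → ℕ, (∀ i, k ≤ i → i < N → i + a i ≤ N) ∧ codePerm N a k d = π := by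
  induction d generalizing k π with
  | zero =>
    refine ⟨0, fun i hi hi' => by simp [hi'.le], signedPerm_ext fun x => ?_⟩
    rw [codePerm_zero]
    change x = _
    by_cases hx : |x| ≤ k
    · exact (hfix x hx).symm
    · exact (π.2.2 x (by omega)).symm
  | succ d ih =>
    have hkN : k < N := by omega
    have hp : |(k : ℤ) + 1| = k + 1 := abs_of_pos (by omega)
    have h1 : (k : ℤ) < |π.1 (k + 1)| := lt_abs_apply_of_fix hfix (by omega)
    have h2 : |π.1 (k + 1)| ≤ N := abs_apply_le π (by omega)
    obtain ⟨c, hc, hσ⟩ : ∃ c : ℕ, k + c ≤ N ∧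
        (wordProd (block N k c)).1 ((k : ℤ) + 1) = π.1 (k + 1) := by
      rcases lt_or_ge (π.1 (k + 1)) 0 with hneg | hpos
      -- A negative letter here must be `-N`: the letter of absolute value `N` cannot stand earlier,
      -- where all is fixed, nor later, where it would be dominated. The full block produces `-N`.
      · refine ⟨N - k, by omega, ?_⟩
        rw [block_apply_self hkN (by omega), if_neg (by omega)]
        obtain ⟨x, hx1, hx2, hx3⟩ := exists_apply_eq_of_abs π (v := N) (by omega) le_rfl
        rcases lt_trichotomy x ((k : ℤ) + 1) with hx | hx | hx
        · rw [hfix x (by rw [abs_of_pos] <;> omega), abs_of_pos (by omega)] at hx3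
          omega
        · rw [hx, abs_of_neg hneg] at hx3
          omega
        · have := hπ _ x (by omega) hx hx2 hneg
          omega
      · rw [abs_of_nonneg hpos] at h1 h2
        obtain ⟨m, hm⟩ := Int.eq_ofNat_of_zero_le (show 0 ≤ π.1 (k + 1) - (k + 1) by omega)
        refine ⟨m, by omega, ?_⟩
        rw [block_apply_self hkN (by omega), if_pos (by omega)]
        omega
    have hρ : wordProd (block N k c) * ((wordProd (block N k c))⁻¹ * π) = π := by group
    have hρfix : ∀ x : ℤ, |x| ≤ (k + 1 : ℕ) → ((wordProd (block N k c))⁻¹ * π).1 x = x := by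
      intro x hx
      apply (wordProd (block N k c)).1.injective
      rw [← mul_apply, hρ]
      rcases lt_or_eq_of_le hx with hlt | heq
      · push_cast at hlt
        rw [hfix x (by omega), block_apply_of_abs_le hkN hc (by omega)]
      · push_cast at heq
        rcases (abs_eq (by omega)).mp heq with rfl | rfl
        · exact hσ.symm
        · rw [apply_neg, apply_neg, hσ]
    obtain ⟨a, ha, ha'⟩ := ih (k := k + 1) (by omega) hρfix
      ((negDominates_block_mul hkN hc hρfix).mp (by rwa [hρ]))
    refine ⟨Function.update a k c, fun i hi hi' => ?_, ?_⟩
    · rcases eq_or_lt_of_le hi with rfl | hlt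
      · simpa using hc
      · rw [Function.update_of_ne (by omega)]
        exact ha i hlt hi'
    · rw [codePerm_succ, Function.update_self, codePerm, codeWord_congr (b := a), ← codePerm, ha',
        hρ]
      intro i hi _
      rw [Function.update_of_ne (by omega)]

/-! ### Recovering the block lengths. -/

/-- The number of later letters of smaller absolute value than the `(i+1)`-st one. -/
noncomputable def later (π : signedPerm N) (i : ℕ) : ℕ :=
  ((Finset.Icc ((i : ℤ) + 2) N).filter fun j => |π.1 j| < |π.1 (i + 1)|).card

/-- The code of a signed permutation. -/
noncomputable def code (π : signedPerm N) (i : ℕ) : ℕ :=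
  later π i + if π.1 (i + 1) < 0 then 1 else 0

theorem card_abs_apply_lt (π : signedPerm N) {v : ℕ} (hv : v ≤ N) :
    ((Finset.Icc 1 (N : ℤ)).filter fun j => |π.1 j| ≤ v).card = v := by
  have : ((Finset.Icc 1 (N : ℤ)).filter fun j => |π.1 j| ≤ v).image (fun j => |π.1 j|) =
      Finset.Icc 1 (v : ℤ) := by
    ext y
    simp only [Finset.mem_image, Finset.mem_filter, Finset.mem_Icc]
    constructor
    · rintro ⟨j, ⟨⟨h1, h2⟩, h3⟩, rfl⟩
      exact ⟨abs_pos.mpr (apply_ne_zero π (by omega)), h3⟩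
    · rintro ⟨h1, h2⟩
      obtain ⟨x, hx1, hx2, hx3⟩ := exists_apply_eq_of_abs π (v := y) (by omega) (by omega)
      exact ⟨x, ⟨⟨hx1, hx2⟩, by omega⟩, hx3⟩
  rw [← Finset.card_image_of_injOn (f := fun j => |π.1 j|), this]
  · simp
  · intro x hx y hy hxy
    simp only [Finset.mem_coe, Finset.mem_filter, Finset.mem_Icc] at hx hy
    simp only [abs_apply_eq_iff] at hxy
    rwa [abs_of_pos (by omega), abs_of_pos (by omega)] at hxy

/-- Earlier and later letters of smaller absolute value than the `(i+1)`-st letter. -/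
theorem later_add_earlier (π : signedPerm N) {i : ℕ} (hi : i < N) :
    (later π i : ℤ) + ((Finset.Icc 1 (i : ℤ)).filter fun j => |π.1 j| < |π.1 (i + 1)|).card + 1 =
      |π.1 (i + 1)| := by
  have hp : |(i : ℤ) + 1| = i + 1 := abs_of_pos (by omega)
  have h1 : 0 < |π.1 (i + 1)| := abs_pos.mpr (apply_ne_zero π (by omega))
  have h2 : |π.1 (i + 1)| ≤ N := abs_apply_le π (by omega)
  obtain ⟨v, hv⟩ := Int.eq_ofNat_of_zero_le (show 0 ≤ |π.1 (i + 1)| - 1 by omega)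
  have hcard := card_abs_apply_lt π (v := v) (by omega)
  have hsplit : (Finset.Icc 1 (N : ℤ)).filter (fun j => |π.1 j| ≤ v) =
      ((Finset.Icc ((i : ℤ) + 2) N).filter fun j => |π.1 j| < |π.1 (i + 1)|) ∪
        (Finset.Icc 1 (i : ℤ)).filter fun j => |π.1 j| < |π.1 (i + 1)| := by
    ext j
    simp only [Finset.mem_union, Finset.mem_filter, Finset.mem_Icc]
    constructor
    · rintro ⟨h3, h4⟩
      have : j ≠ i + 1 := by rintro rfl; omega
      omega
    · omega
  rw [hsplit, Finset.card_union_of_disjoint] at hcard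
  · unfold later
    omega
  · rw [Finset.disjoint_left]
    simp only [Finset.mem_filter, Finset.mem_Icc]
    omega

theorem code_codePerm {a : ℕ → ℕ} {k d : ℕ} (hk : k + d = N)
    (ha : ∀ i, k ≤ i → i < N → i + a i ≤ N) {i : ℕ} (hi : k ≤ i) (hi' : i < N) :
    code (codePerm N a k d) i = a i := by
  induction d generalizing k with
  | zero => omega
  | succ d ih =>
    have hkN : k < N := by omega
    have hc := ha k le_rfl hkN
    have ha' : ∀ i, k + 1 ≤ i → i < N → i + a i ≤ N := fun i hi => ha i (by omega)
    have hρ : ∀ x : ℤ, |x| ≤ (k + 1 : ℕ) → (codePerm N a (k + 1) d).1 x = x :=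
      fun x hx => codePerm_apply_of_abs_le (by omega) ha' hx
    rcases eq_or_lt_of_le hi with rfl | hlt
    · have hval : (codePerm N a k (d + 1)).1 (k + 1) =
          if k + a k < N then (k : ℤ) + a k + 1 else -(N : ℤ) := by
        rw [codePerm_succ, mul_apply, hρ _ (by rw [abs_of_pos (by omega)]; push_cast; rfl),
          block_apply_self hkN hc]
      have h1 := later_add_earlier (codePerm N a k (d + 1)) hkN
      have h2 : ((Finset.Icc 1 (k : ℤ)).filter fun j =>
          |(codePerm N a k (d + 1)).1 j| < |(codePerm N a k (d + 1)).1 (k + 1)|) =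
          Finset.Icc 1 (k : ℤ) := by
        refine Finset.filter_true_of_mem fun j hj => ?_
        rw [Finset.mem_Icc] at hj
        have hj' : |j| = j := abs_of_pos (by omega)
        rw [codePerm_apply_of_abs_le (x := j) hk ha (by omega), hval, hj']
        split_ifs
        · rw [abs_of_pos] <;> omega
        · rw [abs_neg, Nat.abs_cast]; omega
      rw [h2, Int.card_Icc, hval] at h1
      unfold code
      rw [hval]
      split_ifs at h1 ⊢
      · omega
      · rw [abs_of_pos (by omega)] at h1
        omega
      · rw [abs_neg, Nat.abs_cast] at h1
        omega
      · omega
    · rw [← ih (k := k + 1) (by omega) ha' hlt]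
      have hgt : ∀ x : ℤ, (k : ℤ) + 1 < x → (k : ℤ) + 1 < |(codePerm N a (k + 1) d).1 x| :=
        fun x hx => by
          have := lt_abs_apply_of_fix hρ (x := x)
            (by rw [abs_of_pos (by omega)]; push_cast; omega)
          push_cast at this
          exact this
      have hle : ∀ x : ℤ, 1 ≤ x → x ≤ N → |(codePerm N a (k + 1) d).1 x| ≤ N := fun x hx hx' =>
        abs_apply_le _ (by rwa [abs_of_pos (by omega)])
      unfold code later
      rw [codePerm_succ]
      simp only [mul_apply, block_apply_neg_iff hkN hc (hgt ((i : ℤ) + 1) (by omega))]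
      congr 2
      refine Finset.filter_congr fun j hj => ?_
      rw [Finset.mem_Icc] at hj
      exact abs_block_apply_lt_iff hkN hc (hgt j (by omega)) (hle j (by omega) hj.2)
        (hgt _ (by omega)) (hle _ (by omega) (by omega))

/-! ### Reduced words and letter counts. -/

/-- The (zero-based) positions of the negative letters. -/
noncomputable def negatives (π : signedPerm N) : Finset ℕ :=
  (Finset.range N).filter fun i => π.1 (i + 1) < 0

/-- The inverted pairs of positions: the pair `(x, y)` with `0 < x < |y|` stands for the root
`e_x - e_y` if `y` is positive, and for `e_x + e_{-y}` if `y` is negative. -/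
noncomputable def inversions (π : signedPerm N) : Finset (ℤ × ℤ) :=
  (Finset.Icc 1 (N : ℤ) ×ˢ Finset.Icc (-(N : ℤ)) N).filter fun p =>
    p.1 < |p.2| ∧ key N (π.1 p.2) < key N (π.1 p.1)

theorem mem_inversions {π : signedPerm N} {p : ℤ × ℤ} :
    p ∈ inversions π ↔ (1 ≤ p.1 ∧ p.1 < |p.2| ∧ |p.2| ≤ N) ∧
      key N (π.1 p.2) < key N (π.1 p.1) := by
  unfold inversions
  rw [Finset.mem_filter, Finset.mem_product, Finset.mem_Icc, Finset.mem_Icc, abs_le]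
  constructor
  · rintro ⟨⟨⟨_, _⟩, _⟩, _, _⟩
    tauto
  · rintro ⟨⟨h1, h2, h3⟩, h4⟩
    have := abs_le.mpr h3
    exact ⟨⟨⟨h1, by omega⟩, h3⟩, h2, h4⟩

theorem card_negatives_simple_mul (s : Fin N) (π : signedPerm N) :
    (negatives (simple s * π)).card ≤ (negatives π).card + if (s : ℕ) + 1 = N then 1 else 0 := by
  have hs := s.2
  by_cases h : (s : ℕ) + 1 < N
  · rw [if_neg (by omega), add_zero]
    refine Finset.card_le_card fun i hi => ?_
    unfold negatives at hi ⊢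
    rw [Finset.mem_filter] at hi ⊢
    refine ⟨hi.1, ?_⟩
    have := hi.2
    rw [mul_apply, simple_apply_of_lt s h] at this
    split_ifs at this <;> omega
  · rw [if_pos (by omega)]
    -- Only the position of the letter `N` can become negative. If that position is itself negative,
    -- `toNat` inserts a harmless extra element.
    refine (Finset.card_le_card (t := insert ((π⁻¹.1 N) - 1).toNat (negatives π))
      fun i hi => ?_).trans (Finset.card_insert_le _ _)
    unfold negatives at hi ⊢
    rw [Finset.mem_filter] at hi
    rw [Finset.mem_insert, Finset.mem_filter]
    by_cases hN : π.1 (i + 1) = N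
    · left
      rw [← hN, inv_apply_apply]
      omega
    · refine Or.inr ⟨hi.1, ?_⟩
      have := hi.2
      rw [mul_apply, simple_apply_of_not_lt s h] at this
      split_ifs at this <;> omega

/-- A newly inverted pair must consist of two letters exchanged by `s`. For `s_N` these have equal
absolute values, which is excluded; otherwise the pair is unique. -/
theorem card_inversions_simple_mul (s : Fin N) (π : signedPerm N) :
    (inversions (simple s * π)).card ≤ (inversions π).card + if (s : ℕ) + 1 < N then 1 else 0 := by
  have hs := s.2
  have hnew : ∀ p ∈ inversions (simple s * π), p ∉ inversions π →
      (simple s).1 (π.1 p.2) = π.1 p.1 ∧ key N (π.1 p.1) < key N (π.1 p.2) := by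
    intro p hp hp'
    rw [mem_inversions] at hp hp'
    obtain ⟨⟨h1, h2, h3⟩, h4⟩ := hp
    rw [mul_apply, mul_apply] at h4
    have hx : |p.1| = p.1 := abs_of_pos (by omega)
    have b1 : |π.1 p.1| ≤ N := abs_apply_le π (by omega)
    have b2 : |π.1 p.2| ≤ N := abs_apply_le π h3
    have hne := key_ne_key b1 b2 fun h => by
      have := π.1.injective h
      rw [← this] at h2
      omega
    have hlt : key N (π.1 p.1) < key N (π.1 p.2) := by
      by_contra hc
      exact hp' ⟨⟨h1, h2, h3⟩, by omega⟩
    exact ⟨simple_apply_eq_of_key_lt s b2 b1 hlt h4, hlt⟩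
  by_cases h : (s : ℕ) + 1 < N
  · rw [if_pos h]
    -- The letters exchanged are `s + 1, s + 2` or their negatives. The two candidate pairs differ
    -- by swapping the entries and changing both signs, so at most one meets the convention `0 < x <
    -- |y|`.
    let p₁ : ℤ × ℤ := (π⁻¹.1 (s + 1), π⁻¹.1 (s + 2))
    let p₂ : ℤ × ℤ := (π⁻¹.1 (-(s + 2)), π⁻¹.1 (-(s + 1)))
    refine (Finset.card_le_card (t := insert (if 0 < p₁.1 ∧ p₁.1 < |p₁.2| then p₁ else p₂)
      (inversions π)) fun p hp => ?_).trans (Finset.card_insert_le _ _)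
    rw [Finset.mem_insert]
    by_cases hp' : p ∈ inversions π
    · exact Or.inr hp'
    · left
      obtain ⟨h1, h2⟩ := hnew p hp hp'
      rw [mem_inversions] at hp
      have hp1 := inv_apply_apply π p.1
      have hp2 := inv_apply_apply π p.2
      have hcases : (π.1 p.1 = s + 1 ∧ π.1 p.2 = s + 2) ∨
          (π.1 p.1 = -(s + 2) ∧ π.1 p.2 = -(s + 1)) := by
        have b1 : |π.1 p.2| ≤ N := abs_apply_le π hp.1.2.2
        rw [abs_le] at b1
        have k1 := key_cases N (π.1 p.1)
        have k2 := key_cases N (π.1 p.2)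
        rw [simple_apply_of_lt s h] at h1
        split_ifs at h1 <;> omega
      rcases hcases with ⟨e1, e2⟩ | ⟨e1, e2⟩
      · rw [e1] at hp1
        rw [e2] at hp2
        have : p₁ = p := Prod.ext hp1 hp2
        rw [this, if_pos ⟨by omega, hp.1.2.1⟩]
      · rw [e1] at hp1
        rw [e2] at hp2
        have : p₂ = p := Prod.ext hp1 hp2
        rw [this, if_neg]
        rintro ⟨h3, h4⟩
        rw [apply_neg] at hp1 hp2
        change 0 < π⁻¹.1 (s + 1) at h3
        change π⁻¹.1 (s + 1) < |π⁻¹.1 (s + 2)| at h4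
        have h5 := hp.1.2.1
        rw [← hp2, ← hp1, abs_neg, abs_of_pos h3] at h5
        have h6 := hp.1.1
        rw [abs_of_neg (by omega)] at h4
        omega
  · rw [if_neg h, add_zero]
    refine Finset.card_le_card fun p hp => ?_
    by_contra hp'
    obtain ⟨h1, h2⟩ := hnew p hp hp'
    rw [mem_inversions] at hp
    have habs : |π.1 p.1| = |π.1 p.2| := by
      rw [← h1, simple_apply_of_not_lt s h]
      split_ifs with h3 h4
      · rw [h3, abs_neg]
      · rw [h4, abs_neg]
      · rfl
    rw [abs_apply_eq_iff, abs_of_pos (by omega)] at habs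
    omega

theorem card_negatives_wordProd_le (w : List (Fin N)) :
    (negatives (wordProd w)).card ≤ w.countP (fun i : Fin N => (i : ℕ) + 1 = N) := by
  induction w with
  | nil =>
    rw [wordProd_nil, List.countP_nil, Nat.le_zero, Finset.card_eq_zero]
    refine Finset.filter_false_of_mem fun i _ => ?_
    change ¬ ((i : ℤ) + 1 < 0)
    omega
  | cons s w ih =>
    rw [wordProd_cons, List.countP_cons]
    have := card_negatives_simple_mul s (wordProd w)
    simp only [decide_eq_true_eq]
    omega

theorem card_inversions_wordProd_le (w : List (Fin N)) :
    (inversions (wordProd w)).card ≤ w.countP (fun i : Fin N => (i : ℕ) + 1 < N) := by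
  induction w with
  | nil =>
    rw [wordProd_nil, List.countP_nil, Nat.le_zero, Finset.card_eq_zero, Finset.eq_empty_iff_forall_notMem]
    intro p hp
    rw [mem_inversions] at hp
    obtain ⟨⟨h1, h2, h3⟩, h4⟩ := hp
    change key N p.2 < key N p.1 at h4
    have k1 := key_cases N p.1
    have k2 := key_cases N p.2
    rcases abs_cases p.2 with h5 | h5 <;> omega
  | cons s w ih =>
    rw [wordProd_cons, List.countP_cons]
    have := card_inversions_simple_mul s (wordProd w)
    simp only [decide_eq_true_eq]
    omega

theorem countP_add_countP (w : List (Fin N)) :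
    w.countP (fun i : Fin N => (i : ℕ) + 1 < N) + w.countP (fun i : Fin N => (i : ℕ) + 1 = N) =
      w.length := by
  induction w with
  | nil => rfl
  | cons s w ih =>
    have := s.2
    rw [List.countP_cons, List.countP_cons, List.length_cons]
    simp only [decide_eq_true_eq]
    split_ifs <;> omega

/-- The definition counts in the list of underlying natural numbers, obtained by a monadic coercion;
here the count is brought back to the word itself. -/
theorem inv₁_eq_countP (π : signedPerm N) :
    inv₁ π = (reducedWord π).countP (fun i : Fin N => (i : ℕ) + 1 < N) := by
  unfold inv₁
  rw [List.bind_eq_flatMap]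
  simp only [List.pure_def]
  rw [← List.map_eq_flatMap, List.countP_map]
  rfl

theorem inv₂_eq_countP (π : signedPerm N) :
    inv₂ π = (reducedWord π).countP (fun i : Fin N => (i : ℕ) + 1 = N) := by
  unfold inv₂
  rw [List.bind_eq_flatMap]
  simp only [List.pure_def]
  rw [← List.map_eq_flatMap, List.countP_map]
  rfl

theorem sum_later_le_card_inversions (π : signedPerm N) :
    ∑ i ∈ Finset.range N, later π i ≤ (inversions π).card := by
  unfold later
  rw [← Finset.card_sigma]
  refine Finset.card_le_card_of_injOn
    -- The sign makes the second letter equal to `|π j|`. This precedes `π (i + 1)` in the order of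
    -- letters whatever the sign of the latter.
    (fun p => ((p.1 : ℤ) + 1, if 0 < π.1 p.2 then p.2 else -p.2)) ?_ ?_
  · rintro ⟨i, j⟩ hp
    simp only [Finset.mem_coe, Finset.mem_sigma, Finset.mem_range, Finset.mem_filter,
      Finset.mem_Icc] at hp
    obtain ⟨hi, ⟨hj, hj'⟩, hlt⟩ := hp
    rw [Finset.mem_coe, mem_inversions]
    have hjp : |j| = j := abs_of_pos (by omega)
    have hi0 := apply_ne_zero π (x := (i : ℤ) + 1) (by omega)
    have hj0 := apply_ne_zero π (x := j) (by omega)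
    have hNi : |π.1 (i + 1)| ≤ N := abs_apply_le π (by rw [abs_of_pos] <;> omega)
    refine ⟨⟨by simp only; omega, ?_, ?_⟩, ?_⟩
    · simp only
      split_ifs
      · omega
      · rw [abs_neg]; omega
    · simp only
      split_ifs
      · omega
      · rw [abs_neg]; omega
    · have hval : π.1 (if 0 < π.1 j then j else -j) = |π.1 j| := by
        split_ifs with h
        · rw [abs_of_pos h]
        · rw [apply_neg, abs_of_neg (by omega)]
      simp only [hval]
      have k1 := key_cases N |π.1 j|
      have k2 := key_cases N (π.1 (i + 1))
      have := abs_pos.mpr hj0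
      rcases abs_cases (π.1 (i + 1)) with h | h <;> omega
  · rintro ⟨i, j⟩ hp ⟨i', j'⟩ hp' heq
    simp only [Finset.mem_coe, Finset.mem_sigma, Finset.mem_range, Finset.mem_filter,
      Finset.mem_Icc, Prod.mk.injEq] at hp hp' heq
    obtain ⟨h1, h2⟩ := heq
    have h3 : i = i' := by omega
    have h4 : j = j' := by
      split_ifs at h2 <;> omega
    rw [h3, h4]

theorem sum_code_eq (π : signedPerm N) :
    ∑ i ∈ Finset.range N, code π i =
      ∑ i ∈ Finset.range N, later π i + (negatives π).card := by
  unfold code negatives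
  rw [Finset.sum_add_distrib, Finset.card_filter]

theorem length_block {i c : ℕ} (hc : i + c ≤ N) : (block N i c).length = c := by
  induction c with
  | zero => rfl
  | succ c ih => rw [block, dif_pos (by omega), List.length_cons, ih (by omega)]

theorem length_codeWord {a : ℕ → ℕ} {k d : ℕ} (hk : k + d = N)
    (ha : ∀ i, k ≤ i → i < N → i + a i ≤ N) :
    (codeWord N a k d).length = ∑ i ∈ Finset.Ico k N, a i := by
  induction d generalizing k with
  | zero => rw [← hk]; simp [codeWord]
  | succ d ih =>
    rw [codeWord, List.length_append, length_block (ha k le_rfl (by omega)),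
      ih (by omega) fun i hi => ha i (by omega), ← Finset.sum_eq_sum_Ico_succ_bot (by omega)]

/-- The word `codeWord` is reduced, and every other reduced word has the same letter counts. -/
theorem codeWord_counts {a : ℕ → ℕ} (ha : ∀ i, i < N → i + a i ≤ N) :
    length (codePerm N a 0 N) = ∑ i ∈ Finset.range N, a i ∧
      inv₁ (codePerm N a 0 N) = (codeWord N a 0 N).countP (fun i : Fin N => (i : ℕ) + 1 < N) ∧
      inv₂ (codePerm N a 0 N) = (codeWord N a 0 N).countP (fun i : Fin N => (i : ℕ) + 1 = N) := by
  have ha' : ∀ i, 0 ≤ i → i < N → i + a i ≤ N := fun i _ => ha i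
  have h1 := length_codeWord (zero_add N) ha'
  have h2 := sum_later_le_card_inversions (codePerm N a 0 N)
  have h3 := sum_code_eq (codePerm N a 0 N)
  rw [Finset.sum_congr rfl fun i hi =>
    code_codePerm (zero_add N) ha' i.zero_le (Finset.mem_range.mp hi)] at h3
  have h4 := length_le_of_wordProd_eq (w := codeWord N a 0 N) rfl
  obtain ⟨h5, h6⟩ := (exists_isReducedWord (codePerm N a 0 N)).choose_spec
  have h7 := card_negatives_wordProd_le (reducedWord (codePerm N a 0 N))
  have h8 := card_inversions_wordProd_le (reducedWord (codePerm N a 0 N))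
  have h9 := card_negatives_wordProd_le (codeWord N a 0 N)
  have h10 := card_inversions_wordProd_le (codeWord N a 0 N)
  have h11 := countP_add_countP (reducedWord (codePerm N a 0 N))
  have h12 := countP_add_countP (codeWord N a 0 N)
  change wordProd (reducedWord (codePerm N a 0 N)) = _ at h5
  change (reducedWord (codePerm N a 0 N)).length = _ at h6
  rw [h5] at h7 h8
  change (negatives (codePerm N a 0 N)).card ≤ _ at h9
  change (inversions (codePerm N a 0 N)).card ≤ _ at h10
  change length (codePerm N a 0 N) ≤ _ at h4
  rw [← Finset.range_eq_Ico] at h1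
  rw [inv₁_eq_countP, inv₂_eq_countP]
  -- All inequalities are forced to be equalities: the sum of the code is at most inversions plus
  -- negative letters, hence at most the length, hence at most the number of letters of the code
  -- word, which is the sum of the code.
  omega

/-! ### Smaller codes give smaller elements. -/

/-- Deleting the first letter of a block. -/
theorem codeWord_update_pred {a : ℕ → ℕ} {k d i : ℕ} (hk : k + d = N)
    (ha : ∀ j, k ≤ j → j < N → j + a j ≤ N) (hi : k ≤ i) (hi' : i < N) (hpos : 0 < a i) :
    ∃ (L M : List (Fin N)) (x : Fin N), codeWord N a k d = L ++ x :: M ∧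
      codeWord N (Function.update a i (a i - 1)) k d = L ++ M := by
  induction d generalizing k with
  | zero => omega
  | succ d ih =>
    rcases eq_or_lt_of_le hi with rfl | hlt
    · have hc := ha k le_rfl hi'
      obtain ⟨c, hc'⟩ : ∃ c, a k = c + 1 := ⟨a k - 1, by omega⟩
      refine ⟨[], block N k c ++ codeWord N a (k + 1) d, ⟨k + c, by omega⟩, ?_, ?_⟩
      · rw [codeWord, hc', block, dif_pos (by omega)]
        rfl
      · rw [codeWord, Function.update_self, hc', codeWord_congr (b := a)]
        · rfl
        · intro j hj _
          rw [Function.update_of_ne (by omega)]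
    · obtain ⟨L, M, x, h1, h2⟩ := ih (k := k + 1) (by omega) (fun j hj => ha j (by omega)) hlt
      refine ⟨block N k (a k) ++ L, M, x, ?_, ?_⟩
      · rw [codeWord, h1, List.append_assoc]
      · rw [codeWord, h2, Function.update_of_ne (by omega), List.append_assoc]

/-- Lowering one entry of the code by one deletes one letter of a reduced word and leaves a reduced
word, so it is a step of the Bruhat order. -/
theorem bruhatLE_codePerm {a b : ℕ → ℕ} (hb : ∀ i, i < N → i + b i ≤ N)
    (hab : ∀ i, i < N → a i ≤ b i) : BruhatLE (codePerm N a 0 N) (codePerm N b 0 N) := by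
  obtain ⟨n, hn⟩ : ∃ n, n = ∑ i ∈ Finset.range N, b i := ⟨_, rfl⟩
  induction n generalizing b with
  | zero =>
    have : codeWord N a 0 N = codeWord N b 0 N := codeWord_congr fun i _ hi => by
      have := Finset.sum_eq_zero_iff.mp hn.symm i (Finset.mem_range.mpr (by omega))
      have := hab i (by omega)
      omega
    rw [codePerm, this]
    exact Relation.ReflTransGen.refl
  | succ n ih =>
    by_cases h : ∀ i, i < N → a i = b i
    · rw [codePerm, codeWord_congr fun i _ hi => h i (by omega)]
      exact Relation.ReflTransGen.refl
    · push Not at h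
      obtain ⟨i, hi, hne⟩ := h
      have hlt : a i < b i := lt_of_le_of_ne (hab i hi) hne
      obtain ⟨L, M, x, h1, h2⟩ := codeWord_update_pred (zero_add N) (fun j _ => hb j) i.zero_le hi
        (by omega)
      have hb' : ∀ j, j < N → j + Function.update b i (b i - 1) j ≤ N := by
        intro j hj
        have := hb j hj
        rcases eq_or_ne j i with rfl | hji
        · rw [Function.update_self]; omega
        · rwa [Function.update_of_ne hji]
      have hsum : ∑ j ∈ Finset.range N, Function.update b i (b i - 1) j + 1 =
          ∑ j ∈ Finset.range N, b j := by
        rw [Finset.sum_update_of_mem (Finset.mem_range.mpr hi),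
          ← Finset.sum_sdiff (Finset.singleton_subset_iff.mpr (Finset.mem_range.mpr hi)),
          Finset.sum_singleton]
        omega
      refine Relation.ReflTransGen.tail (ih hb' (fun j hj => ?_) (by omega)) ?_
      · rcases eq_or_ne j i with rfl | hji
        · rw [Function.update_self]; omega
        · rw [Function.update_of_ne hji]; exact hab j hj
      -- Inserting `x` between `L` and `M` is right multiplication of `L M` by `M⁻¹ x M`.
      · refine ⟨(wordProd M)⁻¹ * simple x * ((wordProd M)⁻¹)⁻¹, ⟨_, x, rfl⟩, ?_, ?_⟩
        · rw [codePerm, codePerm, h1, h2, wordProd_append, wordProd_append, wordProd_cons]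
          group
        · rw [(codeWord_counts hb').1, (codeWord_counts hb).1]
          omega

/-! ### The code of `ω(μ)`. -/

/-- The letters `s_{k+1}, …, s_N`. -/
def lettersFrom (N k : ℕ) : List (Fin N) := (List.finRange N).drop k

theorem lettersFrom_eq_cons {k : ℕ} (h : k < N) :
    lettersFrom N k = ⟨k, h⟩ :: lettersFrom N (k + 1) := by
  unfold lettersFrom
  rw [List.drop_eq_getElem_cons (by simpa using h)]
  simp

theorem lettersFrom_self : lettersFrom N N = [] := by simp [lettersFrom]

theorem filter_finRange_eq_lettersFrom (k : Fin N) :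
    (List.finRange N).filter (fun j => k ≤ j) = lettersFrom N k := by
  conv_lhs => rw [← List.take_append_drop (k : ℕ) (List.finRange N)]
  rw [List.filter_append, List.filter_eq_nil_iff.mpr, List.nil_append, List.filter_eq_self.mpr]
  · rfl
  · intro j hj
    obtain ⟨n, hn, rfl⟩ := List.mem_drop_iff_getElem.mp hj
    simp [Fin.le_def]
  · intro j hj
    obtain ⟨n, hn, rfl⟩ := List.mem_take_iff_getElem.mp hj
    simp only [List.length_finRange, lt_min_iff] at hn
    simpa [Fin.lt_def] using hn.1

/-- The part of the word of `μ` that comes from the steps of index at least `k`. -/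
def omegaWordFrom (μ : Fin N → Step) (k : ℕ) : List (Fin N) :=
  (lettersFrom N k).reverse.flatMap fun k => if μ k = Step.D then lettersFrom N k else []

theorem omega_eq_wordProd (μ : Fin N → Step) : omega μ = wordProd (omegaWordFrom μ 0) := by
  unfold omega omegaWord omegaWordFrom
  simp only [filter_finRange_eq_lettersFrom]
  rfl

theorem omegaWordFrom_eq_append (μ : Fin N → Step) {k : ℕ} (h : k < N) :
    omegaWordFrom μ k =
      omegaWordFrom μ (k + 1) ++ if μ ⟨k, h⟩ = Step.D then lettersFrom N k else [] := by
  unfold omegaWordFrom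
  rw [lettersFrom_eq_cons h, List.reverse_cons, List.flatMap_append, List.flatMap_singleton,
    lettersFrom_eq_cons h]

theorem simple_mul_comm {i j : Fin N} (h : (i : ℕ) + 2 ≤ j) :
    simple i * simple j = simple j * simple i := by
  have hj := j.2
  refine signedPerm_ext fun x => ?_
  rw [mul_apply, mul_apply]
  have hi : (i : ℕ) + 1 < N := by omega
  by_cases hj' : (j : ℕ) + 1 < N
  · have e1 := simple_apply_of_lt i hi x
    have e2 := simple_apply_of_lt j hj' x
    rw [simple_apply_of_lt i hi ((simple j).1 x), simple_apply_of_lt j hj' ((simple i).1 x)]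
    generalize (simple i).1 x = y at *
    generalize (simple j).1 x = z at *
    split_ifs at e1 <;> split_ifs at e2 <;> omega
  · have e1 := simple_apply_of_lt i hi x
    have e2 := simple_apply_of_not_lt j hj' x
    rw [simple_apply_of_lt i hi ((simple j).1 x), simple_apply_of_not_lt j hj' ((simple i).1 x)]
    generalize (simple i).1 x = y at *
    generalize (simple j).1 x = z at *
    split_ifs at e1 <;> split_ifs at e2 <;> omega

theorem simple_mul_wordProd_comm {i : Fin N} {w : List (Fin N)}
    (h : ∀ j ∈ w, (i : ℕ) + 2 ≤ (j : ℕ)) : simple i * wordProd w = wordProd w * simple i := by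
  induction w with
  | nil => rw [wordProd_nil, one_mul, mul_one]
  | cons s w ih =>
    rw [wordProd_cons, ← mul_assoc, simple_mul_comm (h s (by simp)), mul_assoc,
      ih fun j hj => h j (by simp [hj]), mul_assoc]

theorem le_of_mem_block {i c : ℕ} {j : Fin N} (h : j ∈ block N i c) : i ≤ j := by
  induction c with
  | zero => simp [block] at h
  | succ c ih =>
    rw [block] at h
    split_ifs at h
    · rcases List.mem_cons.mp h with rfl | h
      · exact Nat.le_add_right _ _
      · exact ih h
    · exact ih h

theorem le_of_mem_codeWord {a : ℕ → ℕ} {k d : ℕ} {j : Fin N} (h : j ∈ codeWord N a k d) :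
    k ≤ j := by
  induction d generalizing k with
  | zero => simp [codeWord] at h
  | succ d ih =>
    rcases List.mem_append.mp h with h | h
    · exact le_of_mem_block h
    · exact (Nat.le_succ k).trans (ih h)

theorem block_succ_eq_append {i : ℕ} (hi : i < N) (c : ℕ) :
    block N i (c + 1) = block N (i + 1) c ++ [⟨i, hi⟩] := by
  induction c with
  | zero => simp [block, hi]
  | succ c ih =>
    rw [block, ih, block]
    by_cases h : i + (c + 1) < N
    · rw [dif_pos h, dif_pos (by omega), List.cons_append]
      congr 2
      omega
    · rw [dif_neg h, dif_neg (by omega)]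

/-- Multiplication by `s_{k+1} ⋯ s_N` shifts the code. -/
theorem codePerm_mul_lettersFrom {a b : ℕ → ℕ} {k d : ℕ} (hk : k + (d + 1) = N)
    (hb : ∀ i, k ≤ i → i < N → b i = a (i + 1) + 1) (ha : a N = 0) :
    codePerm N b k (d + 1) = codePerm N a (k + 1) d * wordProd (lettersFrom N k) := by
  have hkN : k < N := by omega
  induction d generalizing k with
  | zero =>
    have h0 : k + 1 = N := hk
    rw [codePerm_succ, codePerm_zero, codePerm_zero, hb k le_rfl hkN, h0, ha,
      block_succ_eq_append hkN, lettersFrom_eq_cons hkN, h0, lettersFrom_self]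
    simp [block]
  | succ d ih =>
    rw [codePerm_succ, ih (k := k + 1) (by omega) (fun i hi => hb i (by omega)) (by omega),
      hb k le_rfl hkN, block_succ_eq_append hkN, wordProd_append, codePerm_succ a (k + 1),
      lettersFrom_eq_cons hkN, wordProd_cons ⟨k, hkN⟩, wordProd_cons, wordProd_nil, mul_one]
    -- The last letter `s_{k+1}` of the first block commutes with all later blocks of the shifted
    -- code, whose letters start at `s_{k+3}`, and so moves to the front of `s_{k+2} ⋯ s_N`.
    have hcomm := simple_mul_wordProd_comm (i := (⟨k, hkN⟩ : Fin N))
      (w := codeWord N a (k + 1 + 1) d) fun j hj => le_of_mem_codeWord hj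
    change _ * codePerm N a (k + 1 + 1) d = codePerm N a (k + 1 + 1) d * _ at hcomm
    simp only [mul_assoc]
    rw [← mul_assoc (simple _), hcomm, mul_assoc]

/-- The number of down steps of index at least `k` and less than `x`. -/
def downs (μ : Fin N → Step) (k x : ℕ) : ℕ :=
  (Finset.univ.filter fun j : Fin N => k ≤ (j : ℕ) ∧ (j : ℕ) < x ∧ μ j = Step.D).card

/-- The number of boxes on a diagonal of the shape of the part of `μ` from index `k` on. -/
def boxCount (μ : Fin N → Step) (k i : ℕ) : ℕ :=
  ((Finset.range (N - i)).filter fun m => m + 1 ≤ downs μ k (i + 1 + m)).card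

theorem downs_succ (μ : Fin N → Step) {k x : ℕ} (hk : k < N) (hx : k < x) :
    downs μ k x = downs μ (k + 1) x + if μ ⟨k, hk⟩ = Step.D then 1 else 0 := by
  unfold downs
  split_ifs with h
  · rw [← Finset.card_insert_of_notMem (a := (⟨k, hk⟩ : Fin N)) (by simp)]
    congr 1
    ext j
    simp only [Finset.mem_insert, Finset.mem_filter, Finset.mem_univ, true_and]
    constructor
    · rintro ⟨h1, h2, h3⟩
      rcases eq_or_lt_of_le h1 with h4 | h4
      · exact Or.inl (Fin.ext h4.symm)
      · exact Or.inr ⟨h4, h2, h3⟩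
    · rintro (rfl | ⟨h1, h2, h3⟩)
      · exact ⟨le_rfl, hx, h⟩
      · exact ⟨by omega, h2, h3⟩
  · rw [add_zero]
    congr 1
    ext j
    simp only [Finset.mem_filter, Finset.mem_univ, true_and]
    constructor
    · rintro ⟨h1, h2, h3⟩
      refine ⟨lt_of_le_of_ne h1 ?_, h2, h3⟩
      rintro rfl
      exact h h3
    · rintro ⟨h1, h2, h3⟩
      exact ⟨by omega, h2, h3⟩

theorem downs_le (μ : Fin N → Step) (k x : ℕ) : downs μ k x ≤ x - k := by
  rw [← Nat.card_Ico]
  refine Finset.card_le_card_of_injOn (fun j => (j : ℕ)) ?_ Fin.val_injective.injOn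
  intro j hj
  simp only [Finset.mem_coe, Finset.mem_filter, Finset.mem_univ, true_and] at hj
  exact Finset.mem_coe.mpr (Finset.mem_Ico.mpr ⟨hj.1, hj.2.1⟩)

theorem downs_mono (μ : Fin N → Step) (k : ℕ) : Monotone (downs μ k) := by
  intro x y hxy
  refine Finset.card_le_card fun j hj => ?_
  simp only [Finset.mem_filter, Finset.mem_univ, true_and] at hj ⊢
  exact ⟨hj.1, by omega, hj.2.2⟩

theorem downs_le_add (μ : Fin N → Step) (k x y : ℕ) : downs μ k (x + y) ≤ downs μ k x + y := by
  have h : downs μ k (x + y) ≤ downs μ k x + downs μ x (x + y) := by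
    refine (Finset.card_le_card fun j hj => ?_).trans (Finset.card_union_le _ _)
    simp only [Finset.mem_union, Finset.mem_filter, Finset.mem_univ, true_and] at hj ⊢
    by_cases hjx : (j : ℕ) < x
    · exact Or.inl ⟨hj.1, hjx, hj.2.2⟩
    · exact Or.inr ⟨by omega, hj.2⟩
  have := downs_le μ x (x + y)
  omega

theorem boxCount_add_le (μ : Fin N → Step) (k : ℕ) {i : ℕ} (hi : i ≤ N) :
    i + boxCount μ k i ≤ N := by
  have := (Finset.card_filter_le (Finset.range (N - i))
    fun m => m + 1 ≤ downs μ k (i + 1 + m))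
  rw [Finset.card_range] at this
  unfold boxCount
  omega

/-- The down step raises each count of down steps by one, so the box `m = 0` is always present and
the others correspond to those of the next diagonal. This is the shift of codes in
`codePerm_mul_lettersFrom`. -/
theorem boxCount_of_down (μ : Fin N → Step) {k i : ℕ} (hk : k < N) (h : μ ⟨k, hk⟩ = Step.D)
    (hki : k ≤ i) (hi : i < N) : boxCount μ k i = boxCount μ (k + 1) (i + 1) + 1 := by
  unfold boxCount
  obtain ⟨n, hn⟩ : ∃ n, N - i = n + 1 := ⟨N - i - 1, by omega⟩
  rw [hn, show N - (i + 1) = n by omega, Finset.card_filter, Finset.card_filter,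
    Finset.sum_range_succ']
  congr 1
  · refine Finset.sum_congr rfl fun m _ => ?_
    rw [downs_succ μ hk (by omega), if_pos h, show i + 1 + (m + 1) = i + 1 + 1 + m by omega]
    simp only [Nat.add_le_add_iff_right]
  · rw [downs_succ μ hk (by omega), if_pos h, if_pos (by omega)]

theorem boxCount_of_not_down (μ : Fin N → Step) {k i : ℕ} (hk : k < N) (h : μ ⟨k, hk⟩ ≠ Step.D)
    (hki : k ≤ i) : boxCount μ k i = boxCount μ (k + 1) i := by
  unfold boxCount
  congr 1
  refine Finset.filter_congr fun m _ => ?_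
  rw [downs_succ μ hk (by omega), if_neg h, add_zero]

theorem boxCount_self (μ : Fin N → Step) (k : ℕ) : boxCount μ (k + 1) k = 0 := by
  unfold boxCount
  rw [Finset.card_eq_zero]
  refine Finset.filter_false_of_mem fun m _ => ?_
  have := downs_le μ (k + 1) (k + 1 + m)
  omega

/-- Passing from `k + 1` to `k`, a down step appends `s_{k+1} ⋯ s_N` and shifts the code; an up step
only adds an empty block. -/
theorem wordProd_omegaWordFrom (μ : Fin N → Step) {k d : ℕ} (hk : k + d = N) :
    wordProd (omegaWordFrom μ k) = codePerm N (boxCount μ k) k d := by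
  induction d generalizing k with
  | zero =>
    have h0 : k = N := hk
    rw [codePerm_zero, omegaWordFrom, h0, lettersFrom_self]
    exact wordProd_nil
  | succ d ih =>
    have hkN : k < N := by omega
    rw [omegaWordFrom_eq_append μ hkN, wordProd_append, ih (by omega)]
    by_cases h : μ ⟨k, hkN⟩ = Step.D
    · rw [if_pos h]
      refine (codePerm_mul_lettersFrom hk (fun i hi hi' => boxCount_of_down μ hkN h hi hi')
        ?_).symm
      have := boxCount_add_le μ (k + 1) (le_refl N)
      omega
    · rw [if_neg h, wordProd_nil, mul_one, codePerm_succ, boxCount_of_not_down μ hkN h le_rfl,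
        boxCount_self, block, wordProd_nil, one_mul, codePerm, codePerm,
        codeWord_congr fun i hi _ => boxCount_of_not_down μ hkN h (by omega)]

theorem omega_eq_codePerm (μ : Fin N → Step) : omega μ = codePerm N (boxCount μ 0) 0 N := by
  rw [omega_eq_wordProd, wordProd_omegaWordFrom μ (zero_add N)]

/-! ### Boxes of the shape, heights and anchor boxes. -/

theorem height_eq (μ : Fin N → Step) {x : ℕ} (hx : x ≤ N) :
    height μ x = x - 2 * downs μ 0 x := by
  unfold height downs
  have h1 : ∀ k : Fin N, (if ((k : ℕ) : ℤ) < x then (if μ k = Step.U then 1 else -1) else 0 : ℤ) =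
      (if (k : ℕ) < x then 1 else 0) -
        2 * if 0 ≤ (k : ℕ) ∧ (k : ℕ) < x ∧ μ k = Step.D then 1 else 0 := by
    intro k
    rcases hμ : μ k <;> by_cases hk : (k : ℕ) < x <;> simp [hk]
  rw [Finset.sum_congr rfl fun k _ => h1 k, Finset.sum_sub_distrib, ← Finset.mul_sum,
    Finset.card_filter]
  push_cast
  congr 1
  rw [Fin.sum_univ_eq_sum_range (fun k => if k < x then (1 : ℤ) else 0), ← Finset.sum_filter,
    Finset.sum_const, nsmul_eq_mul, mul_one]
  congr 1
  have : (Finset.range N).filter (fun k => k < x) = Finset.range x := by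
    ext k
    simp only [Finset.mem_filter, Finset.mem_range]
    omega
  rw [this, Finset.card_range]

/-- Since the height at `x` is `x` minus twice the number of down steps, the lowest corner of the
`m`-th box is on or above `μ` exactly when at least `m + 1` down steps precede it. -/
theorem mem_boxes {μ : Fin N → Step} {i : Fin N} {b : ℤ × ℤ} :
    b ∈ boxes μ i ↔ ∃ m : ℕ, m < N - i ∧ m + 1 ≤ downs μ 0 (i + 1 + m) ∧
      b = ((i : ℤ) + 1 + m, (i : ℤ) - m) := by
  have hi := i.2
  obtain ⟨x, y⟩ := b
  unfold boxes shape
  simp only [Finset.mem_filter, Finset.mem_product, Finset.mem_Icc, Prod.mk.injEq]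
  constructor
  · rintro ⟨⟨⟨⟨h1, h2⟩, h3, h4⟩, -, h5, h6⟩, h7⟩
    obtain ⟨m, hm⟩ := Int.eq_ofNat_of_zero_le (show 0 ≤ x - (i + 1) by omega)
    obtain rfl : x = ((i + 1 + m : ℕ) : ℤ) := by push_cast; omega
    rw [height_eq μ (by omega)] at h6
    exact ⟨m, by omega, by omega, by push_cast; rfl, by omega⟩
  · rintro ⟨m, h1, h2, rfl, rfl⟩
    have h3 := height_eq μ (x := i + 1 + m) (by omega)
    push_cast at h3
    refine ⟨⟨⟨⟨by omega, by omega⟩, by omega, by omega⟩, ⟨i, by ring⟩, by omega, ?_⟩, by ring⟩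
    rw [h3]
    omega

theorem ht_eq (μ : Fin N → Step) (i : Fin N) : ht μ i = boxCount μ 0 i + 1 := by
  unfold ht boxCount
  congr 1
  symm
  refine Finset.card_bij (fun m _ => ((i : ℤ) + 1 + m, (i : ℤ) - m)) ?_ ?_ ?_
  · intro m hm
    rw [Finset.mem_filter, Finset.mem_range] at hm
    exact mem_boxes.mpr ⟨m, hm.1, hm.2, rfl⟩
  · intro m _ m' _ h
    have := (Prod.mk.inj h).1
    omega
  · intro b hb
    obtain ⟨m, h1, h2, rfl⟩ := mem_boxes.mp hb
    exact ⟨m, Finset.mem_filter.mpr ⟨Finset.mem_range.mpr h1, h2⟩, rfl⟩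

theorem exists_anchor_iff (μ : Fin N → Step) (i : Fin N) :
    (∃ b ∈ boxes μ i, b.1 = (N : ℤ)) ↔ N - i ≤ downs μ 0 N := by
  have hi := i.2
  constructor
  · rintro ⟨b, hb, hbN⟩
    obtain ⟨m, h1, h2, rfl⟩ := mem_boxes.mp hb
    simp only at hbN
    rw [show (i : ℕ) + 1 + m = N by omega] at h2
    omega
  · intro h
    refine ⟨_, mem_boxes.mpr ⟨N - i - 1, by omega, ?_, rfl⟩, by simp only; omega⟩
    rw [show (i : ℕ) + 1 + (N - i - 1) = N by omega]
    omega

/-- One step adds at most one down step, so the presence of the last box on a diagonal forces all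
the preceding ones. -/
theorem boxCount_of_anchor (μ : Fin N → Step) {i : ℕ} (h : N - i ≤ downs μ 0 N) :
    boxCount μ 0 i = N - i := by
  unfold boxCount
  rw [Finset.filter_true_of_mem, Finset.card_range]
  intro m hm
  rw [Finset.mem_range] at hm
  have := downs_le_add μ 0 (i + 1 + m) (N - i - 1 - m)
  rw [show i + 1 + m + (N - i - 1 - m) = N by omega] at this
  omega

theorem boxCount_le_downs (μ : Fin N → Step) (i : ℕ) : boxCount μ 0 i ≤ downs μ 0 N := by
  rw [← Finset.card_range (downs μ 0 N)]
  refine Finset.card_le_card fun m hm => ?_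
  rw [Finset.mem_filter, Finset.mem_range] at hm
  have := downs_mono μ 0 (show i + 1 + m ≤ N by omega)
  rw [Finset.mem_range]
  omega

theorem boxCount_le_boxCount (μ : Fin N → Step) {i j : ℕ} (hij : i ≤ j)
    (h : downs μ 0 N < N - j) : boxCount μ 0 i ≤ boxCount μ 0 j := by
  refine Finset.card_le_card fun m hm => ?_
  rw [Finset.mem_filter, Finset.mem_range] at hm ⊢
  have h1 := downs_mono μ 0 (show i + 1 + m ≤ N by omega)
  have h2 := downs_mono μ 0 (show i + 1 + m ≤ j + 1 + m by omega)
  omega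

/-! ### The code bound below `ω(μ)`. -/

/-- The block at `i` raises `i + 1` to `i + 1 + a i`. As the code is weakly increasing, this lies
above every letter that an earlier block moves. -/
theorem codePerm_apply_of_monotone {a : ℕ → ℕ} {k d n : ℕ} (hk : k + d = N)
    (ha : ∀ i, k ≤ i → i < N → i + a i ≤ N) (hmono : ∀ i j, i ≤ j → j ≤ n → a i ≤ a j)
    (hlt : ∀ i, i ≤ n → i + a i < N) {i : ℕ} (hki : k ≤ i) (hin : i ≤ n) :
    (codePerm N a k d).1 (i + 1) = i + 1 + a i := by
  have hiN := hlt i hin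
  induction d generalizing k with
  | zero => omega
  | succ d ih =>
    have hkN : k < N := by omega
    have ha' : ∀ i, k + 1 ≤ i → i < N → i + a i ≤ N := fun i hi => ha i (by omega)
    rw [codePerm_succ, mul_apply]
    rcases eq_or_lt_of_le hki with rfl | hlt'
    · rw [codePerm_apply_of_abs_le (by omega) ha' (by rw [abs_of_pos (by omega)]; push_cast; rfl),
        block_apply_self hkN (by omega), if_pos (by omega)]
      omega
    · have := hmono k i hki hin
      rw [ih (by omega) ha' hlt', block_apply hkN (by omega)]
      split_ifs <;> omega

/-- On a diagonal with an anchor box the bound is the trivial one, `N - i`. Otherwise the code of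
`ω(μ)` is weakly increasing up to `i`, so its first `i + 1` letters are explicit and their ranks
bound those of `π`. -/
theorem code_le_boxCount {π : signedPerm N} {μ : Fin N → Step} (h : BruhatLE π (omega μ))
    (hcode : ∀ i, i < N → i + code π i ≤ N) {i : ℕ} (hi : i < N) : code π i ≤ boxCount μ 0 i := by
  by_cases hanchor : N - i ≤ downs μ 0 N
  · have := hcode i hi
    rw [boxCount_of_anchor μ hanchor]
    omega
  rw [not_le] at hanchor
  have hβ := boxCount_le_downs μ i
  -- The letter of `ω(μ)` at position `j + 1 ≤ i + 1` is at most `j + 1 + boxCount μ 0 i`.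
  have hω : ∀ V : ℕ, min (i + 1) (V - boxCount μ 0 i) ≤ rank π (i + 1) V := by
    intro V
    refine le_trans ?_ (h.rank_le (i + 1) V)
    have hcard : (Finset.Icc (1 : ℤ) (min (i + 1) (V - boxCount μ 0 i) : ℕ)).card =
        min (i + 1) (V - boxCount μ 0 i) := by
      rw [Int.card_Icc]
      omega
    rw [← hcard]
    refine Finset.card_le_card fun x hx => ?_
    rw [Finset.mem_Icc] at hx
    obtain ⟨j, hj⟩ := Int.eq_ofNat_of_zero_le (show 0 ≤ x - 1 by omega)
    obtain rfl : x = j + 1 := by omega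
    have hji : j ≤ i := by omega
    have hβj := boxCount_le_boxCount μ hji hanchor
    rw [Finset.mem_filter, Finset.mem_Icc, omega_eq_codePerm,
      codePerm_apply_of_monotone (n := i) (zero_add N)
        (fun j _ hj => boxCount_add_le μ 0 (by omega))
        (fun j j' hjj' hj' => boxCount_le_boxCount μ hjj' (by omega))
        (fun j hj => by have := boxCount_le_downs μ j; omega) j.zero_le hji]
    refine ⟨by omega, ?_⟩
    rw [key, if_pos (by omega)]
    omega
  -- For `V = N` the minimum is `i + 1`, so all of the first `i + 1` letters are at places up to
  -- `N`, which are the positive ones.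
  have hpos : ∀ x : ℤ, 1 ≤ x → x ≤ i + 1 → 0 < π.1 x := by
    have h1 := hω N
    rw [min_eq_left (by omega)] at h1
    have h2 := Finset.eq_of_subset_of_card_le (Finset.filter_subset
      (fun a => key N (π.1 a) ≤ (N : ℕ)) (Finset.Icc 1 ((i + 1 : ℕ) : ℤ))) 
        (by rw [Int.card_Icc]; exact le_trans (by omega) h1)
    intro x hx hx'
    have h3 : x ∈ Finset.Icc 1 ((i + 1 : ℕ) : ℤ) := by
      rw [Finset.mem_Icc]
      push_cast
      exact ⟨hx, hx'⟩
    rw [← h2, Finset.mem_filter] at h3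
    have h4 := abs_apply_le π (x := x) (by rw [abs_of_pos] <;> omega)
    have h5 := h3.2
    have := apply_ne_zero π (x := x) (by omega)
    rw [abs_le] at h4
    have := key_cases N (π.1 x)
    by_contra hc
    omega
  have hv := hpos (i + 1) (by omega) le_rfl
  have hlater := later_add_earlier π hi
  unfold code
  rw [if_neg (by omega), add_zero]
  rw [abs_of_pos hv] at hlater
  -- With `V = π (i + 1) - 1` the rank counts only earlier, smaller letters. At least `V - boxCount
  -- μ 0 i` of the `V` smaller absolute values occur earlier, which leaves at most `boxCount μ 0 i`
  -- later.
  obtain ⟨V, hV⟩ := Int.eq_ofNat_of_zero_le (show 0 ≤ π.1 (i + 1) - 1 by omega)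
  have h1 := hω V
  have h2 : rank π (i + 1) V ≤
      ((Finset.Icc 1 (i : ℤ)).filter fun j => |π.1 j| < π.1 (i + 1)).card := by
    refine Finset.card_le_card fun x hx => ?_
    rw [Finset.mem_filter, Finset.mem_Icc] at hx ⊢
    obtain ⟨⟨hx1, hx2⟩, hx3⟩ := hx
    push_cast at hx2
    have hx4 := hpos x hx1 hx2
    rw [key, if_pos hx4] at hx3
    rw [abs_of_pos hx4]
    have : x ≠ i + 1 := by rintro rfl; omega
    exact ⟨by omega, by omega⟩
  have h3 : ((Finset.Icc 1 (i : ℤ)).filter fun j => |π.1 j| < π.1 (i + 1)).card ≤ i :=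
    (Finset.card_filter_le _ _).trans (by simp)
  omega

/-! ### Weights of codes. -/

theorem countP_block {i c : ℕ} (hi : i < N) (hc : i + c ≤ N) :
    (block N i c).countP (fun j : Fin N => (j : ℕ) + 1 = N) = if i + c = N then 1 else 0 := by
  induction c with
  | zero => simp [block, hi.ne]
  | succ c ih =>
    rw [block, dif_pos (by omega), List.countP_cons, ih (by omega)]
    simp only [decide_eq_true_eq]
    split_ifs <;> omega

/-- The weight of an entry of a code. -/
def codeWeight {R : Type*} [CommRing R] (q t : R) (N i c : ℕ) : R :=
  if i + c = N then q ^ (c - 1) * t else q ^ c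

theorem weight_block {R : Type*} [CommRing R] (q t : R) {i c : ℕ} (hi : i < N)
    (hc : i + c ≤ N) :
    q ^ (block N i c).countP (fun j : Fin N => (j : ℕ) + 1 < N) *
      t ^ (block N i c).countP (fun j : Fin N => (j : ℕ) + 1 = N) = codeWeight q t N i c := by
  have h1 := countP_add_countP (block N i c)
  rw [length_block hc] at h1
  rw [countP_block hi hc] at h1 ⊢
  unfold codeWeight
  split_ifs at h1 ⊢
  · rw [pow_one, Nat.eq_sub_of_add_eq h1]
  · rw [pow_zero, mul_one, (Nat.add_zero _).symm.trans h1]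

theorem weight_codeWord {R : Type*} [CommRing R] (q t : R) {a : ℕ → ℕ} {k d : ℕ}
    (hk : k + d = N) (ha : ∀ i, k ≤ i → i < N → i + a i ≤ N) :
    q ^ (codeWord N a k d).countP (fun j : Fin N => (j : ℕ) + 1 < N) *
      t ^ (codeWord N a k d).countP (fun j : Fin N => (j : ℕ) + 1 = N) =
      ∏ i ∈ Finset.Ico k N, codeWeight q t N i (a i) := by
  induction d generalizing k with
  | zero => rw [← hk]; simp [codeWord]
  | succ d ih =>
    rw [Finset.prod_eq_prod_Ico_succ_bot (by omega), ← ih (by omega) fun i hi => ha i (by omega),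
      ← weight_block q t (by omega) (ha k le_rfl (by omega)), codeWord, List.countP_append,
      List.countP_append, pow_add, pow_add]
    ring

theorem weight_codePerm {R : Type*} [CommRing R] (q t : R) {a : ℕ → ℕ}
    (ha : ∀ i, i < N → i + a i ≤ N) :
    q ^ inv₁ (codePerm N a 0 N) * t ^ inv₂ (codePerm N a 0 N) =
      ∏ i : Fin N, codeWeight q t N i (a i) := by
  obtain ⟨-, h1, h2⟩ := codeWord_counts ha
  rw [h1, h2, weight_codeWord q t (zero_add N) fun i _ => ha i, ← Finset.range_eq_Ico,
    Finset.prod_range]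

/-! ### The elements below `ω(μ)` and the factors of the product. -/

/-- Avoiding signed permutations below `omega μ` are the signed permutations with code bounded by
the numbers of boxes on the diagonals of the shape. -/
theorem bruhatLE_omega_and_isAvoiding_iff (μ : Fin N → Step) (π : signedPerm N) :
    BruhatLE π (omega μ) ∧ IsAvoiding π ↔
      ∃ a : ℕ → ℕ, (∀ i, i < N → a i ≤ boxCount μ 0 i) ∧ codePerm N a 0 N = π := by
  have hbox : ∀ i, i < N → i + boxCount μ 0 i ≤ N := fun i hi => boxCount_add_le μ 0 hi.le
  rw [isAvoiding_iff_negDominates]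
  constructor
  · rintro ⟨hle, hav⟩
    obtain ⟨a, ha, rfl⟩ := exists_codePerm_eq (zero_add N) (π := π) (fun x hx => by
      rw [abs_nonpos_iff.mp hx, apply_zero]) hav
    have hcode : ∀ i, i < N → code (codePerm N a 0 N) i = a i := fun i hi =>
      code_codePerm (zero_add N) ha i.zero_le hi
    refine ⟨a, fun i hi => ?_, rfl⟩
    rw [← hcode i hi]
    refine code_le_boxCount hle (fun j hj => ?_) hi
    rw [hcode j hj]
    exact ha j j.zero_le hj
  · rintro ⟨a, ha, rfl⟩
    refine ⟨?_, codePerm_negDominates (zero_add N) fun i _ hi => ?_⟩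
    · rw [omega_eq_codePerm]
      exact bruhatLE_codePerm hbox ha
    · have := ha i hi
      have := hbox i hi
      omega

theorem sum_codeWeight_of_anchor {R : Type*} [CommRing R] (q t : R) (μ : Fin N → Step) (i : Fin N)
    (h : N - i ≤ downs μ 0 N) :
    ∑ c ∈ Finset.range (ht μ i), codeWeight q t N i c = qtInt q t (ht μ i) := by
  have hi := i.2
  rw [ht_eq, boxCount_of_anchor μ h, Finset.sum_range_succ]
  unfold qtInt qInt codeWeight
  rw [if_pos (by omega), Nat.add_sub_cancel, show N - (i : ℕ) + 1 - 2 = N - i - 1 by omega]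
  congr 1
  refine Finset.sum_congr rfl fun c hc => ?_
  rw [Finset.mem_range] at hc
  rw [if_neg (by omega)]

/-- Without an anchor box the number of boxes is less than `N - i`, so no block in the sum reaches
`s_N`. -/
theorem sum_codeWeight_of_not_anchor {R : Type*} [CommRing R] (q t : R) (μ : Fin N → Step)
    (i : Fin N) (h : ¬ N - i ≤ downs μ 0 N) :
    ∑ c ∈ Finset.range (ht μ i), codeWeight q t N i c = qInt q (ht μ i) := by
  refine Finset.sum_congr rfl fun c hc => ?_
  have := boxCount_le_downs μ i
  rw [Finset.mem_range, ht_eq] at hc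
  rw [codeWeight, if_neg (by omega)]

end TypeC
open Classical in
theorem mainTheorem4 {R : Type*} [CommRing R] (q t : R) (N : ℕ) (μ : Fin N → TypeC.Step) :
    (∑ π : TypeC.signedPerm N with TypeC.BruhatLE π (TypeC.omega μ) ∧ TypeC.IsAvoiding π,
        q ^ TypeC.inv₁ π * t ^ TypeC.inv₂ π) =
      (∏ i ∈ TypeC.upCirc μ, TypeC.qInt q (TypeC.ht μ i)) *
        ∏ i ∈ TypeC.upStar μ, TypeC.qtInt q t (TypeC.ht μ i) := by
  have hrhs : (∏ i ∈ TypeC.upCirc μ, TypeC.qInt q (TypeC.ht μ i)) *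
        ∏ i ∈ TypeC.upStar μ, TypeC.qtInt q t (TypeC.ht μ i) =
      ∏ i : Fin N, ∑ c ∈ Finset.range (TypeC.ht μ i), TypeC.codeWeight q t N i c := by
    rw [← Finset.prod_filter_mul_prod_filter_not Finset.univ
      (fun i : Fin N => ∃ b ∈ TypeC.boxes μ i, b.1 = (N : ℤ)), mul_comm]
    congr 1
    · refine Finset.prod_congr (by unfold TypeC.upStar; congr) fun i hi => ?_
      rw [Finset.mem_filter, TypeC.exists_anchor_iff] at hi
      exact (TypeC.sum_codeWeight_of_anchor q t μ i hi.2).symm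
    · refine Finset.prod_congr (by unfold TypeC.upCirc; congr) fun i hi => ?_
      rw [Finset.mem_filter, TypeC.exists_anchor_iff] at hi
      exact (TypeC.sum_codeWeight_of_not_anchor q t μ i hi.2).symm
  rw [hrhs, Finset.prod_univ_sum]
  -- Codes are functions on `ℕ`, but only the entries below `N` matter; extension by zero selects
  -- one representative.
  let ext (c : Fin N → ℕ) (i : ℕ) : ℕ := if h : i < N then c ⟨i, h⟩ else 0
  have hext : ∀ (c : Fin N → ℕ) (i : Fin N), ext c i = c i := fun c i => by simp [ext]
  have hbox : ∀ i : Fin N, (i : ℕ) + TypeC.boxCount μ 0 i ≤ N := fun i =>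
    TypeC.boxCount_add_le μ 0 i.2.le
  have hbound : ∀ c ∈ Fintype.piFinset fun i : Fin N => Finset.range (TypeC.ht μ i),
      ∀ i, i < N → ext c i ≤ TypeC.boxCount μ 0 i := by
    intro c hc i hi
    have := Fintype.mem_piFinset.mp hc ⟨i, hi⟩
    rw [Finset.mem_range, TypeC.ht_eq] at this
    have h2 := hext c ⟨i, hi⟩
    simp only at this h2
    omega
  have hvalid : ∀ c ∈ Fintype.piFinset fun i : Fin N => Finset.range (TypeC.ht μ i),
      ∀ i, i < N → i + ext c i ≤ N := fun c hc i hi =>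
    (Nat.add_le_add_left (hbound c hc i hi) i).trans (hbox ⟨i, hi⟩)
  symm
  refine Finset.sum_bij (fun c _ => TypeC.codePerm N (ext c) 0 N) ?_ ?_ ?_ ?_
  · intro c hc
    rw [Finset.mem_filter, TypeC.bruhatLE_omega_and_isAvoiding_iff]
    exact ⟨Finset.mem_univ _, ext c, hbound c hc, rfl⟩
  · intro c hc c' hc' h
    funext i
    rw [← hext c i, ← hext c' i,
      ← TypeC.code_codePerm (zero_add N) (fun j _ => hvalid c hc j) (Nat.zero_le _) i.2,
      ← TypeC.code_codePerm (zero_add N) (fun j _ => hvalid c' hc' j) (Nat.zero_le _) i.2, h]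
  · intro π hπ
    rw [Finset.mem_filter, TypeC.bruhatLE_omega_and_isAvoiding_iff] at hπ
    obtain ⟨-, a, ha, rfl⟩ := hπ
    refine ⟨fun i => a i, Fintype.mem_piFinset.mpr fun i => ?_, ?_⟩
    · rw [Finset.mem_range, TypeC.ht_eq]
      exact Nat.lt_succ_of_le (ha i i.2)
    · rw [TypeC.codePerm, TypeC.codePerm, TypeC.codeWord_congr]
      intro i _ hi
      simp only [ext, dif_pos (show i < N by omega)]
  · intro c hc
    rw [TypeC.weight_codePerm q t (hvalid c hc)]
    exact Finset.prod_congr rfl fun i _ => by rw [hext]
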